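/- Let $d\ge 2$, let $p$ be a homogeneous polynomial of degree $2$ in $d$ variables with complex coefficients such that $\int_{\mathbb S^{d-1}}p\,ds=0$, and let $K(x)=p(x)|x|^{-d-2}$ for $x\in\mathbb R^d\setminus\{0\}$. The tempered distribution $\langle K,\phi\rangle=\lim_{\epsilon\to0}\int_{|x|>\epsilon}K(x)\phi(x)\,dx$ has a Fourier transform $\hat K$ (convention $\hat\phi(\xi)=\int_{\mathbb R^d}\phi(x)e^{i\xi\cdot x}\,dx$) that is a bounded function, continuous on $\mathbb R^d\setminus\{0\}$. Let $Q=[-\pi,\pi]^d$, and let $$F(\tau)=\sum_{m\in\mathbb Z^d,\,m\ne0}K(m)\,e^{im\cdot\tau}$$ be the symbol of the infinite Toeplitz matrix with entries $K(m-n)$ for $m\ne n$ and $0$ for $m=n$ $(m,n\in\mathbb Z^d)$. This series converges unconditionally in $L^2(Q)$, and its sum has a bounded, $2\pi$-periodic (in each variable) representative $F:\mathbb R^d\to\mathbb C$ with the following properties. 1. $F$ is $C^\infty$ in a neighborhood of every point of $Q\setminus\{0\}$. 2. For every $\beta>0$ and every $\tau\in Q\setminus\{0\}$, $$F(\tau)=\sum_{m\in\mathbb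 Z^d,\,m\ne0}K(m)\,\frac{\Gamma(\frac d2+1,\beta^2|m|^2)}{\Gamma(\frac d2+1)}\,e^{im\cdot\tau}+\sum_{n\in\mathbb Z^d}\hat K(\tau+2\pi n)\,e^{-\frac{|\tau+2\pi n|^2}{4\beta^2}},$$ where $\Gamma(a,x)=\int_x^\infty t^{a-1}e^{-t}\,dt$. Both series converge absolutely and exponentially: there are constants $C$ and $c>0$, independent of $\tau\in Q\setminus\{0\}$, such that for every $R\ge0$ the sum of the absolute values of the terms with $|m|>R$ (respectively $|n|>R$) is at most $Ce^{-cR^2}$. 3. There is a function $F_0$, analytic in a neighborhood of $Q$, with $F_0(0)=0$ and $F(\tau)=\hat K(\tau)+F_0(\tau)$ for all $\tau\in Q\setminus\{0\}$. -/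

import Mathlib

/-!
Strongly singular convolution kernels `K(x) = p(x) |x|^(-d-2)` on `ℝ^d`, with `p` a homogeneous
polynomial of degree `2` (complex coefficients), their Fourier transforms as principal value
distributions, and the symbol of the associated infinite Toeplitz matrix `(K(m - n))`.
-/

open MeasureTheory Filter Topology

noncomputable section

/-- The value `p(x)` of a complex polynomial `p` at a point `x ∈ ℝ^d`. -/
def polyAt {d : ℕ} (p : MvPolynomial (Fin d) ℂ) (x : EuclideanSpace ℝ (Fin d)) : ℂ :=
  MvPolynomial.eval (fun j => (x j : ℂ)) p

/-- The cancellation condition: the integral of `p` (equivalently of `K`, as `|x| = 1` there) over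
the unit sphere with its surface measure vanishes. -/
def CancellationCondition {d : ℕ} (p : MvPolynomial (Fin d) ℂ) : Prop :=
  ∫ x : Metric.sphere (0 : EuclideanSpace ℝ (Fin d)) 1,
    polyAt p (x : EuclideanSpace ℝ (Fin d))
      ∂((volume : Measure (EuclideanSpace ℝ (Fin d))).toSphere) = 0

/-- The kernel `K(x) = p(x) |x|^(-d-2)`, used for `x ≠ 0` only. -/
def kernelK {d : ℕ} (p : MvPolynomial (Fin d) ℂ) (x : EuclideanSpace ℝ (Fin d)) : ℂ :=
  polyAt p x / ((‖x‖ ^ (d + 2) : ℝ) : ℂ)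

/-- The Fourier transform `∫ φ(x) e^{i ξ·x} dx`. -/
def fourierPlus {d : ℕ} (φ : EuclideanSpace ℝ (Fin d) → ℂ) (ξ : EuclideanSpace ℝ (Fin d)) : ℂ :=
  ∫ x, φ x * Complex.exp (Complex.I * ((inner ℝ ξ x : ℝ) : ℂ))

/-- `Khat` is the Fourier transform of the tempered distribution `p.v. K`: it is a bounded
function, continuous away from the origin, and `⟨Khat, φ⟩ = ⟨p.v. K, φ̂⟩` for every Schwartz
function `φ`, where `⟨p.v. K, ψ⟩ = lim_{ε → 0} ∫_{|x| > ε} K(x) ψ(x) dx`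
(the existence of the limit is part of the condition).
These properties determine `Khat` on `ℝ^d ∖ {0}`. -/
structure IsKernelSymbol {d : ℕ} (p : MvPolynomial (Fin d) ℂ)
    (Khat : EuclideanSpace ℝ (Fin d) → ℂ) : Prop where
  bounded : ∃ C : ℝ, ∀ ξ, ‖Khat ξ‖ ≤ C
  continuousOn : ContinuousOn Khat {0}ᶜ
  fourier_pv : ∀ φ : SchwartzMap (EuclideanSpace ℝ (Fin d)) ℂ,
    Tendsto
      (fun ε : ℝ => ∫ x in {x : EuclideanSpace ℝ (Fin d) | ε < ‖x‖},
        kernelK p x * fourierPlus (fun y => φ y) x)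
      (𝓝[>] 0) (𝓝 (∫ ξ, Khat ξ * φ ξ))

/-- The lattice point `m ∈ ℤ^d` as a point of `ℝ^d`. -/
def latticePt {d : ℕ} (m : Fin d → ℤ) : EuclideanSpace ℝ (Fin d) :=
  WithLp.toLp 2 (fun j => (m j : ℝ))

/-- The period cube `Q = [-π, π]^d`. -/
def periodCube (d : ℕ) : Set (EuclideanSpace ℝ (Fin d)) :=
  {τ | ∀ j, τ j ∈ Set.Icc (-Real.pi) Real.pi}

/-- The exponential `e^{i m·τ}`. -/
def latticeExp {d : ℕ} (m : Fin d → ℤ) (τ : EuclideanSpace ℝ (Fin d)) : ℂ :=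
  Complex.exp (Complex.I * ((inner ℝ (latticePt m) τ : ℝ) : ℂ))

/-- `F` is a representative (`2π`-periodic in each variable) of the symbol
`∑_{m ∈ ℤ^d, m ≠ 0} K(m) e^{i m·τ}` of the Toeplitz matrix with entries `K(m - n)` for `m ≠ n` and
`0` for `m = n`; the Fourier series converges (unconditionally) in `L²(Q)`. -/
structure IsToeplitzSymbol {d : ℕ} (p : MvPolynomial (Fin d) ℂ)
    (F : EuclideanSpace ℝ (Fin d) → ℂ) : Prop where
  periodic : ∀ (τ : EuclideanSpace ℝ (Fin d)) (n : Fin d → ℤ),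
    F (τ + (2 * Real.pi) • latticePt n) = F τ
  memLp : MemLp F 2 (volume.restrict (periodCube d))
  series : Tendsto
    (fun S : Finset {m : Fin d → ℤ // m ≠ 0} =>
      eLpNorm (fun τ => F τ - ∑ m ∈ S, kernelK p (latticePt m.1) * latticeExp m.1 τ) 2
        (volume.restrict (periodCube d)))
    atTop (𝓝 0)

/-- The upper incomplete Gamma function `Γ(a, x) = ∫_x^∞ t^{a-1} e^{-t} dt`. -/
def upperGamma (a x : ℝ) : ℝ :=
  ∫ t in Set.Ioi x, t ^ (a - 1) * Real.exp (-t)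

/-- The term `K(m) Γ(d/2+1, β²|m|²) / Γ(d/2+1) e^{i m·τ}` of the Ewald Fourier sum. -/
def ewaldFourierTerm {d : ℕ} (p : MvPolynomial (Fin d) ℂ) (β : ℝ) (m : Fin d → ℤ)
    (τ : EuclideanSpace ℝ (Fin d)) : ℂ :=
  kernelK p (latticePt m) *
    ((upperGamma ((d : ℝ) / 2 + 1) (β ^ 2 * ‖latticePt m‖ ^ 2) /
      Real.Gamma ((d : ℝ) / 2 + 1) : ℝ) : ℂ) * latticeExp m τ

/-- The term `Khat(τ + 2πn) e^{-|τ + 2πn|² / (4β²)}` of the Ewald Poisson sum. -/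
def ewaldPoissonTerm {d : ℕ} (Khat : EuclideanSpace ℝ (Fin d) → ℂ) (β : ℝ) (n : Fin d → ℤ)
    (τ : EuclideanSpace ℝ (Fin d)) : ℂ :=
  Khat (τ + (2 * Real.pi) • latticePt n) *
    ((Real.exp (-(‖τ + (2 * Real.pi) • latticePt n‖ ^ 2) / (4 * β ^ 2)) : ℝ) : ℂ)

/-- The series `∑_i a i τ` over a family of lattice points `pt i` converges absolutely for
`τ ∈ S`, and exponentially: the sum of the norms of the terms with `|pt i| > R` is at most
`C e^{-c R²}`, uniformly in `τ ∈ S`, with `c > 0`. -/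
def ExponentiallyConvergentOn {d : ℕ} {ι : Type} (pt : ι → (Fin d → ℤ))
    (a : ι → EuclideanSpace ℝ (Fin d) → ℂ) (S : Set (EuclideanSpace ℝ (Fin d))) : Prop :=
  ∃ C c : ℝ, 0 < c ∧ ∀ τ ∈ S,
    Summable (fun i => ‖a i τ‖) ∧
    ∀ R : ℝ, 0 ≤ R →
      ∑' i : {i : ι // R < ‖latticePt (pt i)‖}, ‖a i.1 τ‖ ≤ C * Real.exp (-c * R ^ 2)

end

/-!
A homogeneous polynomial of degree `2` is a quadratic form, and the cancellation condition says that
its trace vanishes: integrate `p` against a Gaussian in polar coordinates (`trace_eq_zero`). Hence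
`p` times a Gaussian is, up to scaling, its own Fourier transform
(`integral_polyAt_mul_gaussExp`). Superposing these identities over the width `t ∈ (0, T]` of the
Gaussian gives on one side the symbol
`Khat(ξ) = -π^{d/2} / Γ(d/2+1) · p(ξ) / |ξ|²`, damped by `e^{-|ξ|²/(4T)}`, and on the other side the
kernel damped by `1 - Γ(d/2+1, T|x|²) / Γ(d/2+1)` (`integral_kernelSymbol_mul_exp`). As `T → ∞` the
damping disappears, and the multiplication formula identifies `Khat` as the Fourier transform of
`p.v. K`: by the cancellation condition both the principal value and the damped integrals equal the
absolutely convergent integral of `K(x) (ψ(x) - ψ(0) 1_{|x| ≤ 1})`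
(`isKernelSymbol_kernelSymbol`, `IsKernelSymbol.eq_kernelSymbol`).

With `T = β²`, unfolding shows that the Poisson sum `∑_n Khat(τ + 2πn) e^{-|τ + 2πn|²/(4β²)}` is the
function on the torus with Fourier coefficients `K(m) (1 - Γ(d/2+1, β²|m|²) / Γ(d/2+1))`. Adding the
rapidly convergent Fourier sum with the complementary coefficients yields a bounded function
`ewaldSymbol p β` with Fourier coefficients `K(m)`, so that completeness of the characters in `L²`
gives the unconditionally convergent series (`tendsto_eLpNorm_ewaldSymbol_sub`).

The difference `ewaldRemainder p β = ewaldSymbol p β - Khat` is analytic on the period cube. The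
Fourier sum is a series of exponentials with Gaussian coefficients (`analyticAt_tsum_exp`). In the
Poisson sum without the term `n = 0`, the quotients `p(τ + 2πn) / |τ + 2πn|²` form an analytic map
into the Banach algebra of bounded functions of `n`, and the Gaussian factors form an analytic
series of functionals on it (`analyticAt_tsum_ewaldPoissonTerm`). The remaining term
`Khat(τ) (e^{-|τ|²/(4β²)} - 1)` has a removable singularity at the origin. At `τ = 0` both lattice
sums are sums of `p` times a radial weight, which vanish by the symmetries of the cubic lattice and
the zero trace (`ewaldRemainder_zero`). Finally, two values of `β` give the same function in `L²`,
hence remainders that agree almost everywhere on the cube, and everywhere by continuity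
(`ewaldSymbol_eqOn`).
-/

noncomputable section

variable {d : ℕ}

/-! ### Quadratic forms, Gaussians and the trace -/

theorem exists_quadraticForm {p : MvPolynomial (Fin d) ℂ} (hp : p.IsHomogeneous 2) :
    ∃ A : Fin d → Fin d → ℂ, ∀ x, polyAt p x = ∑ j, ∑ k, A j k * ((x j : ℂ) * (x k : ℂ)) := by
  classical
  have key : ∀ s : Fin d →₀ ℕ, ∃ A : Fin d → Fin d → ℂ, s ∈ p.support →
      ∀ x : EuclideanSpace ℝ (Fin d), MvPolynomial.eval (fun j => (x j : ℂ))
        (MvPolynomial.monomial s (p.coeff s)) = ∑ j, ∑ k, A j k * ((x j : ℂ) * (x k : ℂ)) := by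
    intro s
    by_cases hs : s ∈ p.support
    swap
    · exact ⟨0, fun h => absurd h hs⟩
    have h2 : s.degree = 2 := by
      rw [Finsupp.degree_eq_weight_one]
      exact hp (MvPolynomial.mem_support_iff.1 hs)
    have pick : ∀ (u : Fin d →₀ ℕ) (n : ℕ), u.degree = n + 1 →
        ∃ j u', u = Finsupp.single j 1 + u' ∧ u'.degree = n := by
      intro u n hu
      have hne : u ≠ 0 := by
        rintro rfl
        simp at hu
      obtain ⟨j, hj⟩ := Finsupp.ne_iff.1 hne
      have hle : Finsupp.single j 1 ≤ u := by
        rw [Finsupp.single_le_iff]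
        simp at hj
        omega
      refine ⟨j, u - Finsupp.single j 1, (add_tsub_cancel_of_le hle).symm, ?_⟩
      have h3 : (Finsupp.single j 1 + (u - Finsupp.single j 1)).degree = n + 1 := by
        rw [add_tsub_cancel_of_le hle, hu]
      rw [map_add, Finsupp.degree_single] at h3
      omega
    obtain ⟨j, u, rfl, hu⟩ := pick s 1 h2
    obtain ⟨k, v, rfl, hv⟩ := pick u 0 hu
    rw [Finsupp.degree_eq_zero_iff] at hv
    subst hv
    refine ⟨fun a b => if a = j then if b = k then
      p.coeff (Finsupp.single j 1 + (Finsupp.single k 1 + 0)) else 0 else 0, fun _ x => ?_⟩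
    simp [MvPolynomial.eval_monomial, Finsupp.prod_add_index', pow_add, ite_mul]
  choose A hA using key
  refine ⟨fun j k => ∑ s ∈ p.support, A s j k, fun x => ?_⟩
  rw [polyAt, ← MvPolynomial.support_sum_monomial_coeff p, map_sum,
    MvPolynomial.support_sum_monomial_coeff p, Finset.sum_congr rfl fun s hs => hA s hs x,
    Finset.sum_comm]
  refine Finset.sum_congr rfl fun j _ => ?_
  rw [Finset.sum_comm]
  exact Finset.sum_congr rfl fun k _ => by rw [Finset.sum_mul]

theorem polyAt_smul {p : MvPolynomial (Fin d) ℂ} (hp : p.IsHomogeneous 2) (c : ℝ)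
    (x : EuclideanSpace ℝ (Fin d)) : polyAt p (c • x) = (c : ℂ) ^ 2 * polyAt p x := by
  obtain ⟨A, hA⟩ := exists_quadraticForm hp
  simp only [hA, Finset.mul_sum]
  refine Finset.sum_congr rfl fun j _ => Finset.sum_congr rfl fun k _ => ?_
  simp
  ring

theorem polyAt_zero {p : MvPolynomial (Fin d) ℂ} (hp : p.IsHomogeneous 2) :
    polyAt p 0 = 0 := by
  simpa using polyAt_smul hp 0 0

theorem continuous_polyAt (p : MvPolynomial (Fin d) ℂ) : Continuous (polyAt p) := by
  unfold polyAt
  exact (MvPolynomial.continuous_eval p).comp (by fun_prop)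

theorem exists_norm_polyAt_le {p : MvPolynomial (Fin d) ℂ} (hp : p.IsHomogeneous 2) :
    ∃ C : ℝ, 0 ≤ C ∧ ∀ x, ‖polyAt p x‖ ≤ C * ‖x‖ ^ 2 := by
  obtain ⟨A, hA⟩ := exists_quadraticForm hp
  refine ⟨∑ j, ∑ k, ‖A j k‖, by positivity, fun x => ?_⟩
  rw [hA, Finset.sum_mul]
  refine (norm_sum_le _ _).trans (Finset.sum_le_sum fun j _ => ?_)
  rw [Finset.sum_mul]
  refine (norm_sum_le _ _).trans (Finset.sum_le_sum fun k _ => ?_)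
  rw [norm_mul, norm_mul, pow_two]
  have h : ∀ i, ‖(x i : ℂ)‖ ≤ ‖x‖ := fun i => by
    simpa using PiLp.norm_apply_le x i
  gcongr <;> apply h

/-- Integration in polar coordinates: the integral of `p` times a radial function splits into the
spherical mean of `p` and a radial integral, hence vanishes. -/
theorem integral_polyAt_mul_radial (hd : 0 < d) {p : MvPolynomial (Fin d) ℂ}
    (hp : p.IsHomogeneous 2) (hc : CancellationCondition p) (w : ℝ → ℂ) :
    ∫ x : EuclideanSpace ℝ (Fin d), polyAt p x * w ‖x‖ = 0 := by
  set E := EuclideanSpace ℝ (Fin d)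
  have : Nonempty (Fin d) := ⟨⟨0, hd⟩⟩
  have hne : Nontrivial E := inferInstance
  let μ : Measure E := volume
  calc ∫ x : E, polyAt p x * w ‖x‖
      = ∫ x : ({(0)}ᶜ : Set E), polyAt p x.1 * w ‖x.1‖ ∂(μ.comap (↑)) := by
        rw [integral_subtype_comap (measurableSet_singleton _).compl
          fun x => polyAt p x * w ‖x‖, restrict_compl_singleton]
    _ = ∫ z : Metric.sphere (0 : E) 1 × Set.Ioi (0 : ℝ),
          polyAt p z.1.1 * ((z.2.1 : ℂ) ^ 2 * w z.2.1)
          ∂(μ.toSphere.prod (.volumeIoiPow (Module.finrank ℝ E - 1))) := by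
        rw [← μ.measurePreserving_homeomorphUnitSphereProd.integral_comp
          (Homeomorph.measurableEmbedding _)]
        refine integral_congr_ae (.of_forall fun x => ?_)
        have hx : ‖x.1‖ ≠ 0 := norm_ne_zero_iff.2 x.2
        have hs : x.1 = ‖x.1‖ • (‖x.1‖⁻¹ • x.1) := by
          rw [smul_smul, mul_inv_cancel₀ hx, one_smul]
        simp only [homeomorphUnitSphereProd_apply_fst_coe, homeomorphUnitSphereProd_apply_snd_coe]
        conv_lhs => rw [hs, polyAt_smul hp, ← hs]
        ring
    _ = 0 := by
        rw [integral_prod_mul (fun z : Metric.sphere (0 : E) 1 => polyAt p z.1)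
          (fun r : Set.Ioi (0 : ℝ) => ((r.1 : ℂ) ^ 2 * w r.1))]
        have : ∫ z : Metric.sphere (0 : E) 1, polyAt p z.1 ∂μ.toSphere = 0 := hc
        rw [this, zero_mul]

/-- The function `e^{-t|x|² + i ξ·x}`. -/
def gaussExp (t : ℝ) (ξ x : EuclideanSpace ℝ (Fin d)) : ℂ :=
  Complex.exp (-(t : ℂ) * ‖x‖ ^ 2 + Complex.I * ((inner ℝ ξ x : ℝ) : ℂ))

theorem norm_gaussExp (t : ℝ) (ξ x : EuclideanSpace ℝ (Fin d)) :
    ‖gaussExp t ξ x‖ = Real.exp (-t * ‖x‖ ^ 2) := by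
  rw [gaussExp, Complex.norm_exp]
  congr 1
  simp [← Complex.ofReal_pow]

theorem continuous_gaussExp (t : ℝ) (ξ : EuclideanSpace ℝ (Fin d)) :
    Continuous (gaussExp t ξ) := by
  unfold gaussExp
  fun_prop

theorem integrable_norm_pow_mul_gauss (hd : 0 < d) {t : ℝ} (ht : 0 < t) (k : ℕ) :
    Integrable (fun x : EuclideanSpace ℝ (Fin d) => ‖x‖ ^ k * Real.exp (-t * ‖x‖ ^ 2)) := by
  have : Nonempty (Fin d) := ⟨⟨0, hd⟩⟩
  refine (integrable_fun_norm_addHaar (volume : Measure (EuclideanSpace ℝ (Fin d)))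
    (f := fun r : ℝ => r ^ k * Real.exp (-t * r ^ 2))).2 ?_
  have h := (integrable_rpow_mul_exp_neg_mul_sq ht (s := ((d - 1 + k : ℕ) : ℝ))
    (by have : (0 : ℝ) ≤ ((d - 1 + k : ℕ) : ℝ) := Nat.cast_nonneg _
        linarith)).integrableOn (s := Set.Ioi 0)
  refine h.congr_fun (fun r _ => ?_) measurableSet_Ioi
  simp only [Real.rpow_natCast, finrank_euclideanSpace, Fintype.card_fin, smul_eq_mul]
  ring

theorem integrable_mul_gaussExp (hd : 0 < d) {t : ℝ} (ht : 0 < t) (ξ : EuclideanSpace ℝ (Fin d))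
    (k : ℕ) {f : EuclideanSpace ℝ (Fin d) → ℂ} (hf : Continuous f) {C : ℝ}
    (hb : ∀ x, ‖f x‖ ≤ C * ‖x‖ ^ k) : Integrable (fun x => f x * gaussExp t ξ x) := by
  refine ((integrable_norm_pow_mul_gauss hd ht k).const_mul C).mono'
    (hf.mul (continuous_gaussExp t ξ)).aestronglyMeasurable (.of_forall fun x => ?_)
  rw [norm_mul, norm_gaussExp, ← mul_assoc]
  gcongr
  exact hb x

theorem fderiv_gaussExp_single (t : ℝ) (ξ x : EuclideanSpace ℝ (Fin d)) (k : Fin d) :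
    DifferentiableAt ℝ (gaussExp t ξ) x ∧
    fderiv ℝ (gaussExp t ξ) x (EuclideanSpace.single k 1) =
      (-2 * (t : ℂ) * x k + Complex.I * ξ k) * gaussExp t ξ x := by
  have h1 : HasFDerivAt (fun x : EuclideanSpace ℝ (Fin d) => ((‖x‖ ^ 2 : ℝ) : ℂ))
      (Complex.ofRealCLM.comp (2 • innerSL ℝ x)) x :=
    Complex.ofRealCLM.hasFDerivAt.comp x (hasStrictFDerivAt_norm_sq x).hasFDerivAt
  have h2 : HasFDerivAt (fun x : EuclideanSpace ℝ (Fin d) => ((inner ℝ ξ x : ℝ) : ℂ))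
      (Complex.ofRealCLM.comp (innerSL ℝ ξ)) x :=
    (Complex.ofRealCLM.comp (innerSL ℝ ξ)).hasFDerivAt
  have h3 : HasFDerivAt (fun x : EuclideanSpace ℝ (Fin d) => Complex.exp
      (-(t : ℂ) * ((‖x‖ ^ 2 : ℝ) : ℂ) + Complex.I * ((inner ℝ ξ x : ℝ) : ℂ))) _ x :=
    ((h1.const_mul (-(t : ℂ))).add (h2.const_mul Complex.I)).cexp
  have h4 : gaussExp t ξ = fun x => Complex.exp (-(t : ℂ) * ((‖x‖ ^ 2 : ℝ) : ℂ) +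
      Complex.I * ((inner ℝ ξ x : ℝ) : ℂ)) := by
    funext y
    simp [gaussExp]
  rw [h4]
  refine ⟨h3.differentiableAt, ?_⟩
  rw [h3.fderiv]
  simp [EuclideanSpace.inner_single_right]
  ring

/-- Integration by parts, with `∂ₖ e^{-t|x|² + i ξ·x} = (-2 t xₖ + i ξₖ) e^{-t|x|² + i ξ·x}`. -/
theorem integral_mul_coord_mul_gaussExp (hd : 0 < d) {t : ℝ} (ht : 0 < t)
    (ξ : EuclideanSpace ℝ (Fin d)) (n : ℕ) (k : Fin d) {f : EuclideanSpace ℝ (Fin d) → ℂ}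
    (hf : ContDiff ℝ 1 f) {C C' : ℝ} {n' : ℕ}
    (hb : ∀ x, ‖f x‖ ≤ C * ‖x‖ ^ n)
    (hb' : ∀ x, ‖fderiv ℝ f x (EuclideanSpace.single k 1)‖ ≤ C' * ‖x‖ ^ n') :
    2 * (t : ℂ) * ∫ x, f x * x k * gaussExp t ξ x =
      Complex.I * ξ k * (∫ x, f x * gaussExp t ξ x) +
      ∫ x, fderiv ℝ f x (EuclideanSpace.single k 1) * gaussExp t ξ x := by
  have hfc := hf.continuous
  have i1 : Integrable (fun x => f x * gaussExp t ξ x) :=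
    integrable_mul_gaussExp hd ht ξ n hfc hb
  have i2 : Integrable (fun x => f x * x k * gaussExp t ξ x) := by
    refine integrable_mul_gaussExp hd ht ξ (n + 1) (C := C) (by fun_prop) fun x => ?_
    rw [norm_mul, pow_succ, ← mul_assoc]
    have : ‖(x k : ℂ)‖ ≤ ‖x‖ := by simpa using PiLp.norm_apply_le x k
    gcongr
    · exact (norm_nonneg _).trans (hb x)
    · exact hb x
  have i3 : Integrable
      (fun x => fderiv ℝ f x (EuclideanSpace.single k 1) * gaussExp t ξ x) :=
    integrable_mul_gaussExp hd ht ξ n'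
      ((hf.continuous_fderiv (by simp)).clm_apply continuous_const) hb'
  have e : ∀ x, f x * fderiv ℝ (gaussExp t ξ) x (EuclideanSpace.single k 1) =
      (-2 * (t : ℂ)) * (f x * x k * gaussExp t ξ x) +
        (Complex.I * ξ k) * (f x * gaussExp t ξ x) := fun x => by
    rw [(fderiv_gaussExp_single t ξ x k).2]
    ring
  have h := integral_mul_fderiv_eq_neg_fderiv_mul_of_integrable (μ := volume)
    (f := f) (g := gaussExp t ξ) (v := EuclideanSpace.single k 1) i3
    (by
      simp_rw [e]
      exact (i2.const_mul _).add (i1.const_mul _)) i1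
    (fun x _ => (hf.differentiable (by simp)).differentiableAt)
    (fun x _ => (fderiv_gaussExp_single t ξ x k).1)
  simp_rw [e] at h
  rw [integral_add (i2.const_mul _) (i1.const_mul _), integral_const_mul, integral_const_mul] at h
  linear_combination -h

/-- The second moments of a modulated Gaussian. -/
theorem integral_coord_mul_coord_gaussExp (hd : 0 < d) {t : ℝ} (ht : 0 < t)
    (ξ : EuclideanSpace ℝ (Fin d)) (j k : Fin d) :
    4 * (t : ℂ) ^ 2 * ∫ x, (x j : ℂ) * x k * gaussExp t ξ x =
      ((if j = k then 2 * (t : ℂ) else 0) - ξ j * ξ k) * ∫ x, gaussExp t ξ x := by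
  have h1 := integral_mul_coord_mul_gaussExp hd ht ξ 0 j (f := fun _ => 1) (C := 1) (C' := 0)
    (n' := 0)
    contDiff_const (by simp) (by simp)
  let Lj : EuclideanSpace ℝ (Fin d) →L[ℝ] ℂ :=
    Complex.ofRealCLM.comp (EuclideanSpace.proj j)
  have hL : ∀ x, Lj x = (x j : ℂ) := fun x => rfl
  have h2 := integral_mul_coord_mul_gaussExp hd ht ξ 1 k (f := fun x => Lj x) (C := 1)
    (C' := ‖Lj (EuclideanSpace.single k 1)‖) (n' := 0)
    Lj.contDiff (fun x => by simpa [hL] using PiLp.norm_apply_le x j)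
    (fun x => by rw [Lj.fderiv]; simp)
  simp only [Lj.fderiv, integral_const_mul] at h2
  simp only [hL] at h2
  simp only [one_mul, fderiv_fun_const, Pi.zero_apply, _root_.zero_apply, zero_mul,
    integral_zero, add_zero] at h1
  have h5 : (((EuclideanSpace.single k (1:ℝ) : EuclideanSpace ℝ (Fin d)) j : ℝ) : ℂ)
      = if j = k then 1 else 0 := by
    by_cases h : j = k <;> simp [h]
  rw [h5] at h2
  have hI : Complex.I * Complex.I = -1 := Complex.I_mul_I
  split_ifs at h2 ⊢ with hjk
  · linear_combination (2 * (t : ℂ)) * h2 + Complex.I * ξ k * h1 +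
      ξ j * ξ k * (∫ x, gaussExp t ξ x) * hI
  · linear_combination (2 * (t : ℂ)) * h2 + Complex.I * ξ k * h1 +
      ξ j * ξ k * (∫ x, gaussExp t ξ x) * hI

theorem integral_gaussExp {t : ℝ} (ht : 0 < t) (ξ : EuclideanSpace ℝ (Fin d)) :
    ∫ x, gaussExp t ξ x = (((Real.pi / t) ^ ((d : ℝ) / 2) *
      Real.exp (-‖ξ‖ ^ 2 / (4 * t)) : ℝ) : ℂ) := by
  have h := GaussianFourier.integral_cexp_neg_mul_sq_norm_add (b := (t : ℂ)) (by simpa using ht)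
    Complex.I ξ
  unfold gaussExp
  rw [h, finrank_euclideanSpace_fin, Complex.ofReal_mul, Complex.ofReal_cpow (by positivity)]
  push_cast
  rw [Complex.I_sq]
  simp

/-- A quadratic form times a Gaussian has the Fourier transform of a harmonic one, up to a multiple
of the trace. -/
theorem integral_polyAt_mul_gaussExp_eq_trace (hd : 0 < d) {p : MvPolynomial (Fin d) ℂ}
    {A : Fin d → Fin d → ℂ} (hA : ∀ x, polyAt p x = ∑ j, ∑ k, A j k * ((x j : ℂ) * (x k : ℂ)))
    {t : ℝ} (ht : 0 < t) (ξ : EuclideanSpace ℝ (Fin d)) :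
    4 * (t : ℂ) ^ 2 * ∫ x, polyAt p x * gaussExp t ξ x =
      (2 * (t : ℂ) * (∑ j, A j j) - polyAt p ξ) * ∫ x, gaussExp t ξ x := by
  have hint : ∀ j k, Integrable (fun x : EuclideanSpace ℝ (Fin d) =>
      A j k * ((x j : ℂ) * x k * gaussExp t ξ x)) := fun j k => by
    refine (integrable_mul_gaussExp hd ht ξ 2 (C := 1) (by fun_prop) fun x => ?_).const_mul _
    have h : ∀ i, ‖(x i : ℂ)‖ ≤ ‖x‖ := fun i => by simpa using PiLp.norm_apply_le x i
    rw [norm_mul, pow_two, one_mul]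
    gcongr <;> apply h
  have e : ∀ x, polyAt p x * gaussExp t ξ x =
      ∑ j, ∑ k, A j k * ((x j : ℂ) * x k * gaussExp t ξ x) := fun x => by
    rw [hA, Finset.sum_mul]
    refine Finset.sum_congr rfl fun j _ => ?_
    rw [Finset.sum_mul]
    exact Finset.sum_congr rfl fun k _ => by ring
  simp_rw [e]
  rw [integral_finsetSum _ fun j _ => integrable_finsetSum _ fun k _ => hint j k, hA,
    Finset.mul_sum, Finset.mul_sum, ← Finset.sum_sub_distrib, Finset.sum_mul]
  refine Finset.sum_congr rfl fun j _ => ?_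
  have h1 : 2 * (t : ℂ) * A j j = ∑ k, A j k * (if j = k then 2 * (t : ℂ) else 0) := by
    simp [mul_comm]
  rw [integral_finsetSum _ fun k _ => hint j k, Finset.mul_sum, h1, ← Finset.sum_sub_distrib,
    Finset.sum_mul]
  refine Finset.sum_congr rfl fun k _ => ?_
  rw [integral_const_mul]
  linear_combination A j k * integral_coord_mul_coord_gaussExp hd ht ξ j k

/-- The Gaussian moment identity at `ξ = 0`, combined with the polar coordinate formula, turns the
cancellation condition into the vanishing of the trace. -/
theorem trace_eq_zero (hd : 0 < d) {p : MvPolynomial (Fin d) ℂ} (hp : p.IsHomogeneous 2)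
    (hc : CancellationCondition p) {A : Fin d → Fin d → ℂ}
    (hA : ∀ x, polyAt p x = ∑ j, ∑ k, A j k * ((x j : ℂ) * (x k : ℂ))) :
    ∑ j, A j j = 0 := by
  have h := integral_polyAt_mul_gaussExp_eq_trace hd hA one_pos 0
  have h0 : ∫ x : EuclideanSpace ℝ (Fin d), polyAt p x * gaussExp 1 0 x = 0 := by
    rw [← integral_polyAt_mul_radial hd hp hc (fun r => Complex.exp (-(r : ℂ) ^ 2))]
    simp [gaussExp]
  rw [h0, integral_gaussExp one_pos, polyAt_zero hp, mul_zero, sub_zero] at h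
  have h1 : (((Real.pi / 1) ^ ((d : ℝ) / 2) *
      Real.exp (-‖(0 : EuclideanSpace ℝ (Fin d))‖ ^ 2 / (4 * 1)) : ℝ) : ℂ) ≠ 0 :=
    Complex.ofReal_ne_zero.2 (by positivity)
  have h2 := (mul_eq_zero.1 h.symm).resolve_right h1
  simpa using h2

/-- A harmonic quadratic form times a Gaussian is, up to scaling, its own Fourier transform. -/
theorem integral_polyAt_mul_gaussExp (hd : 0 < d) {p : MvPolynomial (Fin d) ℂ}
    (hp : p.IsHomogeneous 2) (hc : CancellationCondition p) {t : ℝ} (ht : 0 < t)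
    (ξ : EuclideanSpace ℝ (Fin d)) :
    ∫ x, polyAt p x * gaussExp t ξ x = -(polyAt p ξ * (((4 * t ^ 2)⁻¹ *
      (Real.pi / t) ^ ((d : ℝ) / 2) * Real.exp (-‖ξ‖ ^ 2 / (4 * t)) : ℝ) : ℂ)) := by
  obtain ⟨A, hA⟩ := exists_quadraticForm hp
  have h := integral_polyAt_mul_gaussExp_eq_trace hd hA ht ξ
  rw [trace_eq_zero hd hp hc hA, integral_gaussExp ht] at h
  have ht0 : (t : ℂ) ≠ 0 := Complex.ofReal_ne_zero.2 ht.ne'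
  have ht' : (4 * (t : ℂ) ^ 2) ≠ 0 := by simp [ht0]
  refine mul_left_cancel₀ ht' (h.trans ?_)
  push_cast
  field_simp
  ring

theorem latticePt_apply (m : Fin d → ℤ) (j : Fin d) : latticePt m j = (m j : ℝ) := rfl

theorem norm_latticePt_sq (m : Fin d → ℤ) : ‖latticePt m‖ ^ 2 = ∑ j, (m j : ℝ) ^ 2 := by
  rw [EuclideanSpace.norm_sq_eq]
  simp [latticePt_apply]

/-- Sums of `p` times a radial weight over the lattice vanish: the off-diagonal terms are odd under
a sign change of one coordinate, and the diagonal ones add up to a multiple of the trace. -/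
theorem tsum_polyAt_mul_radial (hd : 0 < d) {p : MvPolynomial (Fin d) ℂ}
    (hp : p.IsHomogeneous 2) (hc : CancellationCondition p) (w : ℝ → ℂ)
    (hw : Summable fun m : Fin d → ℤ => ‖latticePt m‖ ^ 2 * ‖w ‖latticePt m‖‖) :
    ∑' m : Fin d → ℤ, polyAt p (latticePt m) * w ‖latticePt m‖ = 0 := by
  obtain ⟨A, hA⟩ := exists_quadraticForm hp
  have norm_eq : ∀ m m' : Fin d → ℤ, ∑ j, (m j : ℝ) ^ 2 = ∑ j, (m' j : ℝ) ^ 2 →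
      ‖latticePt m‖ = ‖latticePt m'‖ := fun m m' h => by
    rw [← norm_latticePt_sq, ← norm_latticePt_sq] at h
    exact (sq_eq_sq₀ (norm_nonneg _) (norm_nonneg _)).1 h
  have hs : ∀ j k, Summable fun m : Fin d → ℤ =>
      ((m j : ℂ) * (m k : ℂ)) * w ‖latticePt m‖ := fun j k => by
    refine Summable.of_norm_bounded hw fun m => ?_
    have h : ∀ i, ‖(m i : ℂ)‖ ≤ ‖latticePt m‖ := fun i => by
      simpa [latticePt_apply] using PiLp.norm_apply_le (latticePt m) i
    rw [norm_mul, norm_mul, pow_two]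
    gcongr <;> apply h
  -- The reflection `mⱼ ↦ -mⱼ` changes the sign of the terms and preserves the norm.
  have hoff : ∀ j k, j ≠ k →
      ∑' m : Fin d → ℤ, ((m j : ℂ) * (m k : ℂ)) * w ‖latticePt m‖ = 0 := fun j k hjk => by
    let e : (Fin d → ℤ) ≃ (Fin d → ℤ) :=
      Equiv.piCongrRight fun i => if i = j then Equiv.neg ℤ else Equiv.refl ℤ
    have hn : ∀ m, ‖latticePt (e m)‖ = ‖latticePt m‖ := fun m => by
      refine norm_eq _ _ (Finset.sum_congr rfl fun i _ => ?_)
      by_cases h : i = j <;> simp [e, h]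
    have h := e.tsum_eq fun m : Fin d → ℤ => ((m j : ℂ) * (m k : ℂ)) * w ‖latticePt m‖
    simp_rw [hn] at h
    have h2 : ∀ m, ((e m j : ℂ) * (e m k : ℂ)) * w ‖latticePt m‖ =
        -(((m j : ℂ) * (m k : ℂ)) * w ‖latticePt m‖) := fun m => by
      simp [e, hjk.symm]
    simp_rw [h2, tsum_neg] at h
    exact self_eq_neg.1 h.symm
  -- The transposition of two coordinates preserves the norm.
  have hdiag : ∀ j k, ∑' m : Fin d → ℤ, ((m j : ℂ) * (m j : ℂ)) * w ‖latticePt m‖ =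
      ∑' m : Fin d → ℤ, ((m k : ℂ) * (m k : ℂ)) * w ‖latticePt m‖ := fun j k => by
    let e : (Fin d → ℤ) ≃ (Fin d → ℤ) := Equiv.arrowCongr (Equiv.swap j k) (Equiv.refl ℤ)
    have hn : ∀ m, ‖latticePt (e m)‖ = ‖latticePt m‖ := fun m =>
      norm_eq _ _ (Equiv.sum_comp (Equiv.swap j k).symm fun i => (m i : ℝ) ^ 2)
    rw [← e.tsum_eq]
    simp_rw [hn]
    simp [e]
  have e : ∀ m : Fin d → ℤ, polyAt p (latticePt m) * w ‖latticePt m‖ =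
      ∑ j, ∑ k, A j k * (((m j : ℂ) * (m k : ℂ)) * w ‖latticePt m‖) := fun m => by
    rw [hA, Finset.sum_mul]
    refine Finset.sum_congr rfl fun j _ => ?_
    rw [Finset.sum_mul]
    refine Finset.sum_congr rfl fun k _ => ?_
    simp [latticePt_apply]
    ring
  simp_rw [e]
  rw [Summable.tsum_finsetSum fun j _ => summable_sum fun k _ => (hs j k).mul_left _]
  have h3 : ∀ j, ∑' m : Fin d → ℤ, ∑ k, A j k * (((m j : ℂ) * (m k : ℂ)) * w ‖latticePt m‖) =
      A j j * ∑' m : Fin d → ℤ, ((m ⟨0, hd⟩ : ℂ) * (m ⟨0, hd⟩ : ℂ)) * w ‖latticePt m‖ := by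
    intro j
    rw [Summable.tsum_finsetSum fun k _ => (hs j k).mul_left _, Finset.sum_eq_single j]
    · rw [tsum_mul_left, hdiag j ⟨0, hd⟩]
    · intro k _ hk
      rw [tsum_mul_left, hoff j k hk.symm, mul_zero]
    · simp
  simp_rw [h3]
  rw [← Finset.sum_mul, trace_eq_zero hd hp hc hA, zero_mul]

/-! ### Mellin weights and the incomplete Gamma function -/

/-- The weight is bounded near `t = 0`, since `u² / 2 ≤ e^u` for `u = s / (4t)`. -/
theorem heatWeight_le {s t : ℝ} (hs : 0 < s) (ht : 0 < t) :
    (4 * t ^ 2)⁻¹ * Real.exp (-s / (4 * t)) ≤ 8 / s ^ 2 := by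
  have h := Real.quadratic_le_exp_of_nonneg (x := s / (4 * t)) (by positivity)
  have h1 : (s / (4 * t)) ^ 2 / 2 ≤ Real.exp (s / (4 * t)) := by
    have : 0 < s / (4 * t) := by positivity
    linarith
  have h2 : -s / (4 * t) = -(s / (4 * t)) := by ring
  rw [h2, Real.exp_neg]
  have h3 : (4 * t ^ 2)⁻¹ = 8 / s ^ 2 * ((s / (4 * t)) ^ 2 / 2) := by
    field_simp
    norm_num
  rw [h3, mul_assoc]
  have h4 : (s / (4 * t)) ^ 2 / 2 * (Real.exp (s / (4 * t)))⁻¹ ≤ 1 := by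
    rw [← div_eq_mul_inv, div_le_one (Real.exp_pos _)]
    exact h1
  exact mul_le_of_le_one_right (by positivity) h4

theorem integrableOn_heatWeight {s : ℝ} (hs : 0 < s) (T : ℝ) :
    IntegrableOn (fun t : ℝ => (4 * t ^ 2)⁻¹ * Real.exp (-s / (4 * t))) (Set.Ioc 0 T) := by
  refine Measure.integrableOn_of_bounded (M := 8 / s ^ 2) (by simp) ?_ ?_
  · exact (by fun_prop : Measurable fun t : ℝ =>
      (4 * t ^ 2)⁻¹ * Real.exp (-s / (4 * t))).aestronglyMeasurable
  · refine (ae_restrict_mem measurableSet_Ioc).mono fun t ht => ?_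
    rw [Real.norm_of_nonneg (by positivity)]
    exact heatWeight_le hs ht.1

/-- Integrating the scaled Gaussians over `0 < t ≤ T` produces the factor `e^{-s/(4T)} / s` of the
Poisson sum. -/
theorem integral_heatWeight {s T : ℝ} (hs : 0 < s) (hT : 0 < T) :
    ∫ t in Set.Ioc 0 T, (4 * t ^ 2)⁻¹ * Real.exp (-s / (4 * t)) = Real.exp (-s / (4 * T)) / s := by
  have hder : ∀ t : ℝ, 0 < t → HasDerivAt (fun t => Real.exp (-s / (4 * t)) / s)
      ((4 * t ^ 2)⁻¹ * Real.exp (-s / (4 * t))) t := by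
    intro t ht
    have h1 : HasDerivAt (fun t : ℝ => -s / (4 * t)) (s * (4 * t ^ 2)⁻¹) t := by
      have h := ((hasDerivAt_id t).const_mul 4).inv (by simpa using ht.ne') |>.const_mul (-s)
      refine (h.congr_deriv ?_).congr_of_eventuallyEq (.of_forall fun y => ?_)
      · simp only [id]
        field_simp
      · simp [div_eq_mul_inv]
    refine (h1.exp.div_const s).congr_deriv ?_
    field_simp
  rw [← intervalIntegral.integral_of_le hT.le,
    intervalIntegral.integral_eq_sub_of_hasDerivAt_of_tendsto hT (fa := 0)
      (fb := Real.exp (-s / (4 * T)) / s) (fun t ht => hder t ht.1)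
      ((intervalIntegrable_iff_integrableOn_Ioc_of_le hT.le).2 (integrableOn_heatWeight hs T)) ?_
      ((hder T hT).continuousAt.continuousWithinAt.tendsto), sub_zero]
  have h1 : Tendsto (fun t : ℝ => s / 4 * t⁻¹) (𝓝[>] 0) atTop :=
    tendsto_inv_nhdsGT_zero.const_mul_atTop (by positivity)
  have h2 := (Real.tendsto_exp_neg_atTop_nhds_zero.comp h1).div_const s
  rw [zero_div] at h2
  refine h2.congr fun t => ?_
  simp only [Function.comp_apply]
  rw [neg_div, div_mul_eq_div_div, div_eq_mul_inv (s / 4)]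

/-- The truncated Mellin integral `∫_0^T t^{d/2} e^{-ts} dt`. -/
def lowerWeight (d : ℕ) (T s : ℝ) : ℝ :=
  ∫ t in Set.Ioc 0 T, t ^ ((d : ℝ) / 2) * Real.exp (-(s * t))

theorem integrableOn_rpow_mul_exp_neg (d : ℕ) {r : ℝ} (hr : 0 < r) :
    IntegrableOn (fun t : ℝ => t ^ ((d : ℝ) / 2 + 1 - 1) * Real.exp (-(r * t))) (Set.Ioi 0) := by
  have h := integrableOn_rpow_mul_exp_neg_mul_rpow (p := 1) (s := (d : ℝ) / 2) (b := r)
    (by have : (0 : ℝ) ≤ (d : ℝ) / 2 := by positivity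
        linarith) one_pos hr
  refine h.congr_fun (fun t _ => ?_) measurableSet_Ioi
  simp

theorem lowerWeight_eq (d : ℕ) {T s : ℝ} (hT : 0 < T) (hs : 0 < s) :
    lowerWeight d T s = (s ^ ((d : ℝ) / 2 + 1))⁻¹ *
      (Real.Gamma ((d : ℝ) / 2 + 1) - upperGamma ((d : ℝ) / 2 + 1) (T * s)) := by
  have ha : (0 : ℝ) < (d : ℝ) / 2 + 1 := by positivity
  have hi := integrableOn_rpow_mul_exp_neg d hs
  have hsplit : Set.Ioi (0 : ℝ) = Set.Ioc 0 T ∪ Set.Ioi T := (Set.Ioc_union_Ioi_eq_Ioi hT.le).symm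
  have htot := Real.integral_rpow_mul_exp_neg_mul_Ioi ha hs
  rw [hsplit, setIntegral_union Set.Ioc_disjoint_Ioi_same measurableSet_Ioi
    (hi.mono_set (by rw [hsplit]; exact Set.subset_union_left))
    (hi.mono_set (by rw [hsplit]; exact Set.subset_union_right))] at htot
  have hup : ∫ t in Set.Ioi T, t ^ ((d : ℝ) / 2 + 1 - 1) * Real.exp (-(s * t)) =
      (s ^ ((d : ℝ) / 2 + 1))⁻¹ * upperGamma ((d : ℝ) / 2 + 1) (T * s) := by
    have h := integral_comp_mul_left_Ioi
      (fun t : ℝ => t ^ ((d : ℝ) / 2 + 1 - 1) * Real.exp (-t)) T hs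
    rw [smul_eq_mul, mul_comm s T] at h
    rw [upperGamma, Real.rpow_add_one hs.ne', mul_inv, mul_assoc, ← h, ← integral_const_mul]
    refine setIntegral_congr_fun measurableSet_Ioi fun t ht => ?_
    have ht0 : 0 < t := hT.trans ht
    simp only [add_sub_cancel_right]
    rw [Real.mul_rpow hs.le ht0.le]
    have : s ^ ((d : ℝ) / 2) ≠ 0 := (Real.rpow_pos_of_pos hs _).ne'
    field_simp
  rw [hup, one_div, Real.inv_rpow hs.le] at htot
  simp only [add_sub_cancel_right] at htot
  rw [lowerWeight]
  linear_combination htot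

theorem lowerWeight_nonneg (d : ℕ) (T s : ℝ) : 0 ≤ lowerWeight d T s :=
  setIntegral_nonneg measurableSet_Ioc fun _ ht =>
    mul_nonneg (Real.rpow_nonneg ht.1.le _) (Real.exp_pos _).le

theorem norm_rpow_mul_exp_neg_le {T s t : ℝ} (hs : 0 ≤ s) (ht : t ∈ Set.Ioc 0 T) :
    ‖t ^ ((d : ℝ) / 2) * Real.exp (-(s * t))‖ ≤ T ^ ((d : ℝ) / 2) := by
  rw [norm_mul, Real.norm_of_nonneg (Real.rpow_nonneg ht.1.le _),
    Real.norm_of_nonneg (Real.exp_pos _).le]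
  calc t ^ ((d : ℝ) / 2) * Real.exp (-(s * t)) ≤ t ^ ((d : ℝ) / 2) * 1 := by
        have := ht.1
        gcongr
        rw [Real.exp_le_one_iff]
        have : 0 ≤ s * t := mul_nonneg hs ht.1.le
        linarith
    _ ≤ _ := by
        rw [mul_one]
        exact Real.rpow_le_rpow ht.1.le ht.2 (by positivity)

theorem lowerWeight_le (d : ℕ) {T s : ℝ} (hT : 0 < T) (hs : 0 ≤ s) :
    lowerWeight d T s ≤ T ^ ((d : ℝ) / 2) * T := by
  have h := norm_setIntegral_le_of_norm_le_const (μ := volume) (s := Set.Ioc 0 T)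
    (f := fun t : ℝ => t ^ ((d : ℝ) / 2) * Real.exp (-(s * t))) (C := T ^ ((d : ℝ) / 2))
    (by simp) (fun t ht => norm_rpow_mul_exp_neg_le hs ht)
  have h2 : (volume : Measure ℝ).real (Set.Ioc 0 T) = T := by simp [hT.le]
  rw [h2] at h
  exact (le_abs_self _).trans h

theorem upperGamma_nonneg {a x : ℝ} (hx : 0 ≤ x) : 0 ≤ upperGamma a x :=
  setIntegral_nonneg measurableSet_Ioi fun _ ht =>
    mul_nonneg (Real.rpow_nonneg (hx.trans (le_of_lt ht)) _) (Real.exp_pos _).le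

/-- One half of the exponential is spent on the decay, the other on convergence of the integral. -/
theorem exists_upperGamma_le (d : ℕ) :
    ∃ C : ℝ, 0 ≤ C ∧ ∀ x : ℝ, 0 ≤ x → upperGamma ((d : ℝ) / 2 + 1) x ≤ C * Real.exp (-x / 2) := by
  have hi := integrableOn_rpow_mul_exp_neg d (r := 1 / 2) (by norm_num)
  refine ⟨∫ t in Set.Ioi 0, t ^ ((d : ℝ) / 2 + 1 - 1) * Real.exp (-(1 / 2 * t)),
    setIntegral_nonneg measurableSet_Ioi fun _ ht =>
      mul_nonneg (Real.rpow_nonneg (le_of_lt ht) _) (Real.exp_pos _).le, fun x hx => ?_⟩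
  have hsub : Set.Ioi x ⊆ Set.Ioi 0 := Set.Ioi_subset_Ioi hx
  calc upperGamma ((d : ℝ) / 2 + 1) x
      ≤ ∫ t in Set.Ioi x, t ^ ((d : ℝ) / 2 + 1 - 1) * Real.exp (-(1 / 2 * t)) *
          Real.exp (-x / 2) := by
        refine setIntegral_mono_on ?_ ((hi.mono_set hsub).mul_const _) measurableSet_Ioi
          fun t ht => ?_
        · simpa using (integrableOn_rpow_mul_exp_neg d one_pos).mono_set hsub
        · rw [mul_assoc, ← Real.exp_add]
          have ht0 : 0 < t := lt_of_le_of_lt hx ht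
          have : x < t := ht
          gcongr
          linarith
    _ ≤ _ := by
        rw [integral_mul_const]
        gcongr
        exact (ae_restrict_mem measurableSet_Ioi).mono fun t ht =>
          mul_nonneg (Real.rpow_nonneg (le_of_lt ht) _) (Real.exp_pos _).le

theorem tendsto_upperGamma (d : ℕ) {s : ℝ} (hs : 0 < s) :
    Tendsto (fun T : ℝ => upperGamma ((d : ℝ) / 2 + 1) (T * s)) atTop (𝓝 0) := by
  obtain ⟨C, _, hC⟩ := exists_upperGamma_le d
  have h1 : Tendsto (fun T : ℝ => T * s / 2) atTop atTop :=
    (tendsto_id.atTop_mul_const hs).atTop_div_const (by norm_num)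
  have h2 := (Real.tendsto_exp_neg_atTop_nhds_zero.comp h1).const_mul C
  rw [mul_zero] at h2
  refine squeeze_zero' ?_ ?_ h2
  · filter_upwards [eventually_ge_atTop 0] with T hT
    exact upperGamma_nonneg (by positivity)
  · filter_upwards [eventually_ge_atTop 0] with T hT
    refine (hC _ (by positivity)).trans (le_of_eq ?_)
    simp only [Function.comp_apply]
    congr 2
    ring

theorem kernelK_zero {p : MvPolynomial (Fin d) ℂ} (hp : p.IsHomogeneous 2) : kernelK p 0 = 0 := by
  rw [kernelK, polyAt_zero hp, zero_div]

/-- The radial cutoff function turning `K` into the damped kernel of level `T`. -/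
def ewaldCutoff (d : ℕ) (T r : ℝ) : ℝ :=
  r ^ (d + 2) * (lowerWeight d T (r ^ 2) / Real.Gamma ((d : ℝ) / 2 + 1))

theorem kernelK_mul_ewaldCutoff {p : MvPolynomial (Fin d) ℂ} (hp : p.IsHomogeneous 2) (T : ℝ)
    (x : EuclideanSpace ℝ (Fin d)) :
    kernelK p x * ewaldCutoff d T ‖x‖ =
      polyAt p x * ((lowerWeight d T (‖x‖ ^ 2) / Real.Gamma ((d : ℝ) / 2 + 1) : ℝ) : ℂ) := by
  rcases eq_or_ne x 0 with rfl | hx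
  · rw [polyAt_zero hp, kernelK_zero hp, zero_mul, zero_mul]
  have : ((‖x‖ ^ (d + 2) : ℝ) : ℂ) ≠ 0 :=
    Complex.ofReal_ne_zero.2 (pow_pos (norm_pos_iff.2 hx) _).ne'
  rw [kernelK, ewaldCutoff, Complex.ofReal_mul]
  field_simp

theorem ewaldCutoff_eq (d : ℕ) {T r : ℝ} (hT : 0 < T) (hr : 0 < r) :
    ewaldCutoff d T r = 1 - upperGamma ((d : ℝ) / 2 + 1) (T * r ^ 2) /
      Real.Gamma ((d : ℝ) / 2 + 1) := by
  have hG : Real.Gamma ((d : ℝ) / 2 + 1) ≠ 0 := (Real.Gamma_pos_of_pos (by positivity)).ne'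
  have hpow : (r ^ 2) ^ ((d : ℝ) / 2 + 1) = r ^ (d + 2) := by
    rw [← Real.rpow_natCast r 2, ← Real.rpow_mul hr.le, ← Real.rpow_natCast r (d + 2)]
    congr 1
    push_cast
    ring
  rw [ewaldCutoff, lowerWeight_eq d hT (by positivity), hpow]
  field_simp

/-- Truncating the Mellin representation of `|x|^{-d-2}` multiplies `K` by the complement of the
incomplete Gamma quotient. -/
theorem polyAt_mul_lowerWeight {p : MvPolynomial (Fin d) ℂ} (hp : p.IsHomogeneous 2) {T : ℝ}
    (hT : 0 < T) (x : EuclideanSpace ℝ (Fin d)) :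
    polyAt p x * ((lowerWeight d T (‖x‖ ^ 2) / Real.Gamma ((d : ℝ) / 2 + 1) : ℝ) : ℂ) =
      kernelK p x * ((1 - upperGamma ((d : ℝ) / 2 + 1) (T * ‖x‖ ^ 2) /
        Real.Gamma ((d : ℝ) / 2 + 1) : ℝ) : ℂ) := by
  rcases eq_or_ne x 0 with rfl | hx
  · rw [polyAt_zero hp, kernelK_zero hp, zero_mul, zero_mul]
  · rw [← kernelK_mul_ewaldCutoff hp, ewaldCutoff_eq d hT (norm_pos_iff.2 hx)]

/-! ### The symbol of the kernel and its damped versions -/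

/-- The explicit Fourier transform `-π^{d/2} / Γ(d/2+1) · p(ξ) / |ξ|²` of the principal value
distribution `p.v. K`; its value at the origin is `0`. -/
def kernelSymbol (p : MvPolynomial (Fin d) ℂ) (ξ : EuclideanSpace ℝ (Fin d)) : ℂ :=
  -(((Real.pi ^ ((d : ℝ) / 2) / Real.Gamma ((d : ℝ) / 2 + 1) : ℝ) : ℂ) *
    (polyAt p ξ / ((‖ξ‖ ^ 2 : ℝ) : ℂ)))

/-- The function `p(ξ) e^{-|ξ|²/(4T)} / |ξ|²` is a superposition of `p` times Gaussians, and
integration against `h` commutes with the superposition. -/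
theorem integral_polyAt_heatMixture {p : MvPolynomial (Fin d) ℂ} (hp : p.IsHomogeneous 2) {T : ℝ}
    (hT : 0 < T) {h : EuclideanSpace ℝ (Fin d) → ℂ} (hm : AEStronglyMeasurable h)
    (hi : Integrable fun ξ => ‖h ξ‖ * Real.exp (-‖ξ‖ ^ 2 / (4 * T))) :
    ∫ ξ, polyAt p ξ * h ξ * ((Real.exp (-‖ξ‖ ^ 2 / (4 * T)) / ‖ξ‖ ^ 2 : ℝ) : ℂ) =
      ∫ t in Set.Ioc 0 T, ∫ ξ, polyAt p ξ * h ξ *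
        (((4 * t ^ 2)⁻¹ * Real.exp (-‖ξ‖ ^ 2 / (4 * t)) : ℝ) : ℂ) := by
  obtain ⟨C, hC0, hC⟩ := exists_norm_polyAt_le hp
  have hmeas : AEStronglyMeasurable
      (Function.uncurry fun (ξ : EuclideanSpace ℝ (Fin d)) (t : ℝ) => polyAt p ξ * h ξ *
        (((4 * t ^ 2)⁻¹ * Real.exp (-‖ξ‖ ^ 2 / (4 * t)) : ℝ) : ℂ))
      (volume.prod (volume.restrict (Set.Ioc 0 T))) := by
    refine AEStronglyMeasurable.mul
      (((continuous_polyAt p).aestronglyMeasurable.mul hm).comp_fst) ?_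
    have : Measurable fun z : EuclideanSpace ℝ (Fin d) × ℝ =>
        (((4 * z.2 ^ 2)⁻¹ * Real.exp (-‖z.1‖ ^ 2 / (4 * z.2)) : ℝ) : ℂ) := by fun_prop
    exact this.aestronglyMeasurable
  have hint : Integrable
      (Function.uncurry fun (ξ : EuclideanSpace ℝ (Fin d)) (t : ℝ) => polyAt p ξ * h ξ *
        (((4 * t ^ 2)⁻¹ * Real.exp (-‖ξ‖ ^ 2 / (4 * t)) : ℝ) : ℂ))
      (volume.prod (volume.restrict (Set.Ioc 0 T))) := by
    rw [integrable_prod_iff hmeas]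
    refine ⟨.of_forall fun ξ => ?_, ?_⟩
    · rcases eq_or_ne ξ 0 with rfl | hξ
      · simp [Function.uncurry, polyAt_zero hp]
      · have h1 := integrableOn_heatWeight (s := ‖ξ‖ ^ 2) (by positivity) T
        exact (Integrable.ofReal (𝕜 := ℂ) h1).const_mul (polyAt p ξ * h ξ)
    · refine (hi.const_mul C).mono' hmeas.norm.integral_prod_right' (.of_forall fun ξ => ?_)
      simp only [Function.uncurry, norm_mul, Complex.norm_real]
      rw [integral_const_mul, Real.norm_of_nonneg (by positivity)]
      rcases eq_or_ne ξ 0 with rfl | hξ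
      · simp only [polyAt_zero hp, norm_zero, zero_mul]
        positivity
      · have hξ' : 0 < ‖ξ‖ ^ 2 := by positivity
        have h2 : ∫ t in Set.Ioc 0 T, ‖(4 * t ^ 2)⁻¹‖ * ‖Real.exp (-‖ξ‖ ^ 2 / (4 * t))‖ =
            Real.exp (-‖ξ‖ ^ 2 / (4 * T)) / ‖ξ‖ ^ 2 := by
          rw [← integral_heatWeight hξ' hT]
          refine integral_congr_ae (.of_forall fun t => ?_)
          simp only
          rw [Real.norm_of_nonneg (by positivity), Real.norm_of_nonneg (by positivity)]
        rw [h2]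
        calc ‖polyAt p ξ‖ * ‖h ξ‖ * (Real.exp (-‖ξ‖ ^ 2 / (4 * T)) / ‖ξ‖ ^ 2)
            ≤ C * ‖ξ‖ ^ 2 * ‖h ξ‖ * (Real.exp (-‖ξ‖ ^ 2 / (4 * T)) / ‖ξ‖ ^ 2) := by
              gcongr
              exact hC ξ
          _ = C * (‖h ξ‖ * Real.exp (-‖ξ‖ ^ 2 / (4 * T))) := by
              field_simp
  rw [← integral_integral_swap hint]
  refine integral_congr_ae (.of_forall fun ξ => ?_)
  simp only
  rw [integral_const_mul, integral_complex_ofReal]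
  rcases eq_or_ne ξ 0 with rfl | hξ
  · simp [polyAt_zero hp]
  · rw [integral_heatWeight (by positivity) hT]

theorem kernelSymbol_mul_exp_mul (p : MvPolynomial (Fin d) ℂ) (T : ℝ)
    (h : EuclideanSpace ℝ (Fin d) → ℂ) (ξ : EuclideanSpace ℝ (Fin d)) :
    kernelSymbol p ξ * ((Real.exp (-‖ξ‖ ^ 2 / (4 * T)) : ℝ) : ℂ) * h ξ =
      -((Real.pi ^ ((d : ℝ) / 2) / Real.Gamma ((d : ℝ) / 2 + 1) : ℝ) : ℂ) *
        (polyAt p ξ * h ξ * ((Real.exp (-‖ξ‖ ^ 2 / (4 * T)) / ‖ξ‖ ^ 2 : ℝ) : ℂ)) := by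
  rw [kernelSymbol]
  push_cast
  ring

theorem integrable_exp_neg_norm_sq_div (hd : 0 < d) {T : ℝ} (hT : 0 < T) :
    Integrable fun ξ : EuclideanSpace ℝ (Fin d) => Real.exp (-‖ξ‖ ^ 2 / (4 * T)) := by
  have h := integrable_norm_pow_mul_gauss hd (t := (4 * T)⁻¹) (by positivity) 0
  refine h.congr (.of_forall fun ξ => ?_)
  simp only [pow_zero, one_mul]
  congr 1
  rw [div_eq_mul_inv]
  ring

/-- The inverse Fourier transform of the damped symbol is `K` damped by the complementary
incomplete Gamma quotient. -/
theorem integral_kernelSymbol_mul_exp (hd : 0 < d) {p : MvPolynomial (Fin d) ℂ}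
    (hp : p.IsHomogeneous 2) (hc : CancellationCondition p) {T : ℝ} (hT : 0 < T)
    (x : EuclideanSpace ℝ (Fin d)) :
    ∫ ξ, kernelSymbol p ξ * ((Real.exp (-‖ξ‖ ^ 2 / (4 * T)) : ℝ) : ℂ) *
        Complex.exp (Complex.I * ((inner ℝ x ξ : ℝ) : ℂ)) =
      (((2 * Real.pi) ^ d : ℝ) : ℂ) * (polyAt p x *
        ((lowerWeight d T (‖x‖ ^ 2) / Real.Gamma ((d : ℝ) / 2 + 1) : ℝ) : ℂ)) := by
  have hnorm : ∀ ξ, ‖Complex.exp (Complex.I * ((inner ℝ x ξ : ℝ) : ℂ))‖ = 1 := fun ξ => by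
    rw [mul_comm, Complex.norm_exp_ofReal_mul_I]
  have hmix := integral_polyAt_heatMixture hp hT
    (h := fun ξ => Complex.exp (Complex.I * ((inner ℝ x ξ : ℝ) : ℂ)))
    (by fun_prop : Continuous _).aestronglyMeasurable (by
      simp only [hnorm, one_mul]
      exact integrable_exp_neg_norm_sq_div hd hT)
  have hin : ∀ t ∈ Set.Ioc 0 T, ∫ ξ, polyAt p ξ *
      Complex.exp (Complex.I * ((inner ℝ x ξ : ℝ) : ℂ)) *
        (((4 * t ^ 2)⁻¹ * Real.exp (-‖ξ‖ ^ 2 / (4 * t)) : ℝ) : ℂ) =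
      -(polyAt p x * (((4 * Real.pi) ^ ((d : ℝ) / 2) : ℝ) : ℂ)) *
        ((t ^ ((d : ℝ) / 2) * Real.exp (-(‖x‖ ^ 2 * t)) : ℝ) : ℂ) := by
    intro t ht
    have ht0 : 0 < t := ht.1
    have h1 := integral_polyAt_mul_gaussExp hd hp hc (t := (4 * t)⁻¹) (by positivity) x
    have h2 : ∀ ξ, polyAt p ξ * Complex.exp (Complex.I * ((inner ℝ x ξ : ℝ) : ℂ)) *
        (((4 * t ^ 2)⁻¹ * Real.exp (-‖ξ‖ ^ 2 / (4 * t)) : ℝ) : ℂ) =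
        (((4 * t ^ 2)⁻¹ : ℝ) : ℂ) * (polyAt p ξ * gaussExp (4 * t)⁻¹ x ξ) := fun ξ => by
      rw [gaussExp, Complex.exp_add, Complex.ofReal_mul, Complex.ofReal_exp]
      have : (((-‖ξ‖ ^ 2 / (4 * t) : ℝ)) : ℂ) = -(((4 * t)⁻¹ : ℝ) : ℂ) * (‖ξ‖ : ℂ) ^ 2 := by
        push_cast
        rw [div_eq_mul_inv]
        ring
      rw [this]
      ring
    simp_rw [h2]
    rw [integral_const_mul, h1]
    have h3 : (4 * ((4 * t)⁻¹) ^ 2)⁻¹ * (Real.pi / (4 * t)⁻¹) ^ ((d : ℝ) / 2) *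
        Real.exp (-‖x‖ ^ 2 / (4 * (4 * t)⁻¹)) = (4 * t ^ 2) * ((4 * Real.pi) ^ ((d : ℝ) / 2) *
          (t ^ ((d : ℝ) / 2) * Real.exp (-(‖x‖ ^ 2 * t)))) := by
      have e1 : (4 * ((4 * t)⁻¹) ^ 2)⁻¹ = 4 * t ^ 2 := by
        field_simp
      have e2 : Real.pi / (4 * t)⁻¹ = (4 * Real.pi) * t := by
        field_simp
      have e3 : -‖x‖ ^ 2 / (4 * (4 * t)⁻¹) = -(‖x‖ ^ 2 * t) := by
        field_simp
      rw [e1, e2, e3, Real.mul_rpow (by positivity) ht0.le]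
      ring
    rw [h3]
    have ht' : (t : ℂ) ≠ 0 := Complex.ofReal_ne_zero.2 ht0.ne'
    push_cast
    field_simp
  have hG : ((Real.Gamma ((d : ℝ) / 2 + 1) : ℝ) : ℂ) ≠ 0 :=
    Complex.ofReal_ne_zero.2 (Real.Gamma_pos_of_pos (by positivity)).ne'
  have hpi : (2 * Real.pi) ^ d = Real.pi ^ ((d : ℝ) / 2) * (4 * Real.pi) ^ ((d : ℝ) / 2) := by
    rw [← Real.mul_rpow Real.pi_pos.le (by positivity),
      show Real.pi * (4 * Real.pi) = (2 * Real.pi) ^ (2 : ℝ) by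
        rw [Real.rpow_two]
        ring,
      ← Real.rpow_mul (by positivity), ← Real.rpow_natCast]
    congr 1
    ring
  simp_rw [kernelSymbol_mul_exp_mul p T
    (fun ξ => Complex.exp (Complex.I * ((inner ℝ x ξ : ℝ) : ℂ)))]
  rw [integral_const_mul, hmix, setIntegral_congr_fun measurableSet_Ioc hin, integral_const_mul,
    integral_complex_ofReal, ← lowerWeight, hpi]
  push_cast
  field_simp

/-- The multiplication formula `∫ Khat φ = ∫ K φ̂` for the damped kernel and symbol. -/
theorem integral_kernelSymbol_mul_eq_fourierPlus (hd : 0 < d) {p : MvPolynomial (Fin d) ℂ}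
    (hp : p.IsHomogeneous 2) (hc : CancellationCondition p) {T : ℝ} (hT : 0 < T)
    {φ : EuclideanSpace ℝ (Fin d) → ℂ} (hφ : Integrable φ)
    (hψ : Integrable fun x => polyAt p x * fourierPlus φ x) :
    ∫ ξ, kernelSymbol p ξ * ((Real.exp (-‖ξ‖ ^ 2 / (4 * T)) : ℝ) : ℂ) * φ ξ =
      ∫ x, polyAt p x *
        ((lowerWeight d T (‖x‖ ^ 2) / Real.Gamma ((d : ℝ) / 2 + 1) : ℝ) : ℂ) *
          fourierPlus φ x := by
  have hmix := integral_polyAt_heatMixture hp hT hφ.aestronglyMeasurable (by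
    refine hφ.norm.mono' (hφ.aestronglyMeasurable.norm.mul
      (by fun_prop : Continuous _).aestronglyMeasurable) (.of_forall fun ξ => ?_)
    rw [norm_mul, norm_norm, Real.norm_of_nonneg (Real.exp_pos _).le]
    refine mul_le_of_le_one_right (norm_nonneg _) (Real.exp_le_one_iff.2 ?_)
    exact div_nonpos_of_nonpos_of_nonneg (by simp) (by positivity))
  have hin : ∀ t ∈ Set.Ioc 0 T, ∫ ξ, polyAt p ξ * φ ξ *
        (((4 * t ^ 2)⁻¹ * Real.exp (-‖ξ‖ ^ 2 / (4 * t)) : ℝ) : ℂ) =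
      -((((Real.pi ^ ((d : ℝ) / 2))⁻¹ : ℝ) : ℂ)) * ∫ x, polyAt p x * fourierPlus φ x *
        ((t ^ ((d : ℝ) / 2) * Real.exp (-(‖x‖ ^ 2 * t)) : ℝ) : ℂ) := by
    intro t ht
    have ht0 : 0 < t := ht.1
    have hfub : Integrable (Function.uncurry fun ξ x : EuclideanSpace ℝ (Fin d) =>
        φ ξ * (polyAt p x * gaussExp t ξ x)) (volume.prod volume) := by
      obtain ⟨C, hC0, hC⟩ := exists_norm_polyAt_le hp
      have h1 := hφ.mul_prod
        (integrable_mul_gaussExp hd ht0 0 2 (continuous_polyAt p) (C := C) hC)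
      refine h1.norm.mono' ?_ (.of_forall fun z => ?_)
      · refine hφ.aestronglyMeasurable.comp_fst.mul (Continuous.aestronglyMeasurable ?_)
        have := continuous_polyAt p
        unfold gaussExp
        fun_prop
      · simp [Function.uncurry, norm_gaussExp]
    have hcoef : ∀ ξ, polyAt p ξ * φ ξ *
        (((4 * t ^ 2)⁻¹ * Real.exp (-‖ξ‖ ^ 2 / (4 * t)) : ℝ) : ℂ) =
        -((((Real.pi / t) ^ ((d : ℝ) / 2))⁻¹ : ℝ) : ℂ) *
          ∫ x, φ ξ * (polyAt p x * gaussExp t ξ x) := fun ξ => by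
      rw [integral_const_mul, integral_polyAt_mul_gaussExp hd hp hc ht0]
      have : (((Real.pi / t) ^ ((d : ℝ) / 2) : ℝ) : ℂ) ≠ 0 :=
        Complex.ofReal_ne_zero.2 (by positivity)
      push_cast
      field_simp
    simp_rw [hcoef]
    rw [integral_const_mul, integral_integral_swap hfub]
    have hx : ∀ x, ∫ ξ, φ ξ * (polyAt p x * gaussExp t ξ x) =
        polyAt p x * fourierPlus φ x * ((Real.exp (-(‖x‖ ^ 2 * t)) : ℝ) : ℂ) := fun x => by
      rw [fourierPlus, ← integral_const_mul, ← integral_mul_const]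
      refine integral_congr_ae (.of_forall fun ξ => ?_)
      simp only
      rw [gaussExp, Complex.exp_add, real_inner_comm, Complex.ofReal_exp]
      have : ((-(‖x‖ ^ 2 * t) : ℝ) : ℂ) = -(t : ℂ) * (‖x‖ : ℂ) ^ 2 := by
        push_cast
        ring
      rw [this]
      ring
    simp_rw [hx]
    rw [← integral_const_mul, ← integral_const_mul]
    refine integral_congr_ae (.of_forall fun x => ?_)
    simp only
    rw [Real.div_rpow Real.pi_pos.le ht0.le, inv_div]
    push_cast
    ring
  have hfub : Integrable (Function.uncurry fun (t : ℝ) (x : EuclideanSpace ℝ (Fin d)) =>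
      polyAt p x * fourierPlus φ x * ((t ^ ((d : ℝ) / 2) * Real.exp (-(‖x‖ ^ 2 * t)) : ℝ) : ℂ))
      ((volume.restrict (Set.Ioc 0 T)).prod volume) := by
    have h1 := (integrable_const (μ := volume.restrict (Set.Ioc 0 T))
      ((T ^ ((d : ℝ) / 2) : ℝ) : ℂ)).mul_prod hψ
    refine h1.norm.mono' ?_ ?_
    · refine (hψ.aestronglyMeasurable.comp_snd).mul ?_
      have : Measurable fun z : ℝ × EuclideanSpace ℝ (Fin d) =>
        ((z.1 ^ ((d : ℝ) / 2) * Real.exp (-(‖z.2‖ ^ 2 * z.1)) : ℝ) : ℂ) := by fun_prop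
      exact this.aestronglyMeasurable
    · have hae : ∀ᵐ z : ℝ × EuclideanSpace ℝ (Fin d)
          ∂((volume.restrict (Set.Ioc 0 T)).prod volume), z.1 ∈ Set.Ioc 0 T :=
        Measure.quasiMeasurePreserving_fst.ae (ae_restrict_mem measurableSet_Ioc)
      refine hae.mono fun z hz => ?_
      simp only [Function.uncurry]
      rw [norm_mul, mul_comm, norm_mul, norm_mul _ (polyAt p z.2 * fourierPlus φ z.2), norm_mul,
        Complex.norm_real, Complex.norm_real, Real.norm_of_nonneg (Real.rpow_nonneg hT.le _)]
      gcongr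
      exact norm_rpow_mul_exp_neg_le (by positivity) hz
  simp_rw [kernelSymbol_mul_exp_mul p T φ]
  rw [integral_const_mul, hmix, setIntegral_congr_fun measurableSet_Ioc hin, integral_const_mul,
    integral_integral_swap hfub, ← integral_const_mul, ← integral_const_mul]
  refine integral_congr_ae (.of_forall fun x => ?_)
  simp only
  rw [integral_const_mul, integral_complex_ofReal, ← lowerWeight]
  have hG : ((Real.Gamma ((d : ℝ) / 2 + 1) : ℝ) : ℂ) ≠ 0 :=
    Complex.ofReal_ne_zero.2 (Real.Gamma_pos_of_pos (by positivity)).ne'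
  have hpi : ((Real.pi ^ ((d : ℝ) / 2) : ℝ) : ℂ) ≠ 0 :=
    Complex.ofReal_ne_zero.2 (by positivity)
  rw [Complex.ofReal_div, Complex.ofReal_div, Complex.ofReal_inv]
  field_simp

/-! ### The Fourier transform of the principal value -/

theorem exists_norm_kernelSymbol_le {p : MvPolynomial (Fin d) ℂ} (hp : p.IsHomogeneous 2) :
    ∃ C : ℝ, 0 ≤ C ∧ ∀ ξ, ‖kernelSymbol p ξ‖ ≤ C := by
  obtain ⟨C, hC0, hC⟩ := exists_norm_polyAt_le hp
  refine ⟨‖((Real.pi ^ ((d : ℝ) / 2) / Real.Gamma ((d : ℝ) / 2 + 1) : ℝ) : ℂ)‖ * C, by positivity,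
    fun ξ => ?_⟩
  rw [kernelSymbol, norm_neg, norm_mul]
  gcongr
  rw [norm_div, Complex.norm_real, norm_pow, norm_norm]
  exact div_le_of_le_mul₀ (by positivity) hC0 (hC ξ)

theorem continuousOn_kernelSymbol (p : MvPolynomial (Fin d) ℂ) :
    ContinuousOn (kernelSymbol p) {0}ᶜ := by
  unfold kernelSymbol
  refine (continuousOn_const.mul ((continuous_polyAt p).continuousOn.div
    (by fun_prop) fun ξ hξ => ?_)).neg
  have : ‖ξ‖ ≠ 0 := norm_ne_zero_iff.2 hξ
  exact Complex.ofReal_ne_zero.2 (by positivity)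

theorem measurable_kernelSymbol (p : MvPolynomial (Fin d) ℂ) : Measurable (kernelSymbol p) := by
  have := (continuous_polyAt p).measurable
  unfold kernelSymbol
  fun_prop

theorem exists_norm_kernelK_le {p : MvPolynomial (Fin d) ℂ} (hp : p.IsHomogeneous 2) :
    ∃ C : ℝ, 0 ≤ C ∧ ∀ x, ‖kernelK p x‖ ≤ C / ‖x‖ ^ d := by
  obtain ⟨C, hC0, hC⟩ := exists_norm_polyAt_le hp
  refine ⟨C, hC0, fun x => ?_⟩
  rcases eq_or_ne x 0 with rfl | hx
  · rw [kernelK_zero hp, norm_zero]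
    positivity
  · have hx' : 0 < ‖x‖ := norm_pos_iff.2 hx
    rw [kernelK, norm_div, Complex.norm_real, norm_pow, norm_norm]
    calc ‖polyAt p x‖ / ‖x‖ ^ (d + 2) ≤ C * ‖x‖ ^ 2 / ‖x‖ ^ (d + 2) := by
          gcongr
          exact hC x
      _ = C / ‖x‖ ^ d := by
          field_simp
          ring

theorem measurable_kernelK (p : MvPolynomial (Fin d) ℂ) : Measurable (kernelK p) := by
  have := (continuous_polyAt p).measurable
  unfold kernelK
  fun_prop

/-- With this sign and normalization the transform is the inverse Fourier transform of Mathlib,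
rescaled; in particular it preserves the Schwartz space. -/
theorem exists_schwartz_fourierPlus (φ : SchwartzMap (EuclideanSpace ℝ (Fin d)) ℂ) :
    ∃ ψ : SchwartzMap (EuclideanSpace ℝ (Fin d)) ℂ, ∀ x, fourierPlus (fun y => φ y) x = ψ x := by
  have hpi : (2 * Real.pi)⁻¹ ≠ 0 := by positivity
  let e : EuclideanSpace ℝ (Fin d) ≃L[ℝ] EuclideanSpace ℝ (Fin d) :=
    ContinuousLinearEquiv.smulLeft (Units.mk0 _ hpi)
  refine ⟨SchwartzMap.compCLMOfContinuousLinearEquiv ℂ e (FourierTransformInv.fourierInv φ),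
    fun x => ?_⟩
  have he : e x = (2 * Real.pi)⁻¹ • x := rfl
  rw [SchwartzMap.compCLMOfContinuousLinearEquiv_apply, Function.comp_apply,
    SchwartzMap.fourierInv_coe, Real.fourierInv_eq', fourierPlus, he]
  refine integral_congr_ae (.of_forall fun y => ?_)
  simp only [smul_eq_mul, inner_smul_right]
  rw [mul_comm, real_inner_comm x y, mul_comm Complex.I]
  congr 4
  field_simp

theorem measurable_lowerWeight (d : ℕ) (T : ℝ) : Measurable (lowerWeight d T) := by
  have h : StronglyMeasurable fun z : ℝ × ℝ => z.2 ^ ((d : ℝ) / 2) * Real.exp (-(z.1 * z.2)) :=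
    (by fun_prop : Measurable _).stronglyMeasurable
  exact (h.integral_prod_right' (ν := volume.restrict (Set.Ioc 0 T))).measurable

/-- Subtracting the value at the centre on the unit ball makes `K ψ` absolutely integrable. -/
theorem integrable_kernelK_mul_sub (hd : 0 < d) {p : MvPolynomial (Fin d) ℂ}
    (hp : p.IsHomogeneous 2) (ψ : SchwartzMap (EuclideanSpace ℝ (Fin d)) ℂ) :
    Integrable fun x => kernelK p x * (ψ x - if ‖x‖ ≤ 1 then ψ 0 else 0) := by
  have : Nonempty (Fin d) := ⟨⟨0, hd⟩⟩
  obtain ⟨C, hC0, hC⟩ := exists_norm_kernelK_le hp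
  obtain ⟨L, hL0, hL⟩ := ψ.decay 0 1
  have hlip : ∀ x, ‖ψ x - ψ 0‖ ≤ L * ‖x‖ := fun x => by
    have h := Convex.norm_image_sub_le_of_norm_fderiv_le (𝕜 := ℝ) (f := ψ) (C := L)
      (s := Set.univ) (x := 0) (y := x) (fun y _ => ψ.differentiableAt)
      (fun y _ => by simpa [norm_iteratedFDeriv_one] using hL y) convex_univ trivial trivial
    simpa using h
  have hrad : Integrable fun x : EuclideanSpace ℝ (Fin d) =>
      (if ‖x‖ ≤ 1 then ‖x‖ / ‖x‖ ^ d else 0) := by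
    refine (integrable_fun_norm_addHaar (volume : Measure (EuclideanSpace ℝ (Fin d)))
      (f := fun r : ℝ => if r ≤ 1 then r / r ^ d else 0)).2 ?_
    have h1 : IntegrableOn (Set.indicator (Set.Iic 1) fun _ : ℝ => (1 : ℝ)) (Set.Ioi 0) := by
      rw [integrableOn_indicator_iff measurableSet_Iic]
      refine integrableOn_const ?_
      rw [Set.inter_comm, Set.Ioi_inter_Iic]
      simp
    refine h1.congr_fun (fun r hr => ?_) measurableSet_Ioi
    have hr0 : (0 : ℝ) < r := hr
    simp only [Set.indicator, Set.mem_Iic, finrank_euclideanSpace, Fintype.card_fin, smul_eq_mul]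
    split_ifs
    · rw [← mul_div_assoc, ← pow_succ, Nat.sub_add_cancel hd, div_self (by positivity)]
    · simp
  refine ((hrad.const_mul (C * L)).add (ψ.integrable.norm.const_mul C)).mono' ?_
    (.of_forall fun x => ?_)
  · refine (measurable_kernelK p).aestronglyMeasurable.mul
      (ψ.continuous.aestronglyMeasurable.sub (Measurable.aestronglyMeasurable ?_))
    exact Measurable.ite (measurableSet_le measurable_norm measurable_const) measurable_const
      measurable_const
  · simp only [Pi.add_apply]
    rw [norm_mul]
    split_ifs with hx
    · calc ‖kernelK p x‖ * ‖ψ x - ψ 0‖ ≤ C / ‖x‖ ^ d * (L * ‖x‖) := by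
            gcongr
            · exact hC x
            · exact hlip x
        _ = C * L * (‖x‖ / ‖x‖ ^ d) := by ring
        _ ≤ _ := le_add_of_nonneg_right (by positivity)
    · rw [sub_zero, mul_zero, zero_add]
      gcongr
      refine (hC x).trans (div_le_self hC0 (one_le_pow₀ (not_le.1 hx).le))

/-- For every radial cutoff that makes `K` integrable near the origin, the cancellation condition
allows the value at the centre to be subtracted. -/
theorem integral_kernelK_mul_radial_mul (hd : 0 < d) {p : MvPolynomial (Fin d) ℂ}
    (hp : p.IsHomogeneous 2) (hc : CancellationCondition p)
    (ψ : SchwartzMap (EuclideanSpace ℝ (Fin d)) ℂ) {w : ℝ → ℝ} (hw : Measurable w)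
    (hw1 : ∀ r, 0 ≤ r → ‖w r‖ ≤ 1) {M : ℝ} (hM : ∀ x, ‖x‖ ≤ 1 → ‖kernelK p x * w ‖x‖‖ ≤ M) :
    ∫ x, kernelK p x * w ‖x‖ * ψ x =
      ∫ x, (w ‖x‖ : ℂ) * (kernelK p x * (ψ x - if ‖x‖ ≤ 1 then ψ 0 else 0)) := by
  have hwm : Measurable fun x : EuclideanSpace ℝ (Fin d) => (w ‖x‖ : ℂ) :=
    Complex.measurable_ofReal.comp (hw.comp measurable_norm)
  have i1 : Integrable fun x =>
      (w ‖x‖ : ℂ) * (kernelK p x * (ψ x - if ‖x‖ ≤ 1 then ψ 0 else 0)) := by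
    refine (integrable_kernelK_mul_sub hd hp ψ).norm.mono'
      (hwm.aestronglyMeasurable.mul (integrable_kernelK_mul_sub hd hp ψ).aestronglyMeasurable)
      (.of_forall fun x => ?_)
    rw [norm_mul]
    refine mul_le_of_le_one_left (norm_nonneg _) ?_
    simpa using hw1 _ (norm_nonneg x)
  -- The subtracted part is radial times `p`, and integrable because of the cutoff.
  have i2 : Integrable fun x =>
      (Metric.closedBall (0 : EuclideanSpace ℝ (Fin d)) 1).indicator
        (fun x => kernelK p x * w ‖x‖ * ψ 0) x := by
    rw [integrable_indicator_iff Metric.isClosed_closedBall.measurableSet]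
    refine Measure.integrableOn_of_bounded (M := M * ‖ψ 0‖) measure_closedBall_lt_top.ne
      (((measurable_kernelK p).mul hwm).mul_const _).aestronglyMeasurable
      ((ae_restrict_mem Metric.isClosed_closedBall.measurableSet).mono fun x hx => ?_)
    rw [norm_mul]
    gcongr
    exact hM x (by simpa using hx)
  have h0 : ∫ x, (Metric.closedBall (0 : EuclideanSpace ℝ (Fin d)) 1).indicator
        (fun x => kernelK p x * w ‖x‖ * ψ 0) x = 0 := by
    rw [← integral_polyAt_mul_radial hd hp hc
      (fun r => if r ≤ 1 then w r * ψ 0 / ((r ^ (d + 2) : ℝ) : ℂ) else 0)]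
    refine integral_congr_ae (.of_forall fun x => ?_)
    by_cases hx : ‖x‖ ≤ 1
    · rw [Set.indicator_of_mem (by simpa using hx)]
      simp only [hx, if_true, kernelK]
      ring
    · rw [Set.indicator_of_notMem (by simpa using hx)]
      simp [hx]
  have h1 := integral_add i1 i2
  rw [h0, add_zero] at h1
  rw [← h1]
  refine integral_congr_ae (.of_forall fun x => ?_)
  by_cases hx : ‖x‖ ≤ 1
  · simp only
    rw [Set.indicator_of_mem (by simpa using hx), if_pos hx]
    ring
  · simp only
    rw [Set.indicator_of_notMem (by simpa using hx), if_neg hx]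
    ring

theorem norm_ewaldCutoff_le (d : ℕ) {T r : ℝ} (hT : 0 < T) (hr : 0 ≤ r) :
    ‖ewaldCutoff d T r‖ ≤ 1 := by
  have hG : 0 < Real.Gamma ((d : ℝ) / 2 + 1) := Real.Gamma_pos_of_pos (by positivity)
  have h0 : 0 ≤ ewaldCutoff d T r :=
    mul_nonneg (by positivity) (div_nonneg (lowerWeight_nonneg d T _) hG.le)
  rw [Real.norm_of_nonneg h0]
  rcases hr.eq_or_lt with rfl | hr
  · simp [ewaldCutoff]
  · rw [ewaldCutoff_eq d hT hr]
    have : 0 ≤ upperGamma ((d : ℝ) / 2 + 1) (T * r ^ 2) / Real.Gamma ((d : ℝ) / 2 + 1) :=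
      div_nonneg (upperGamma_nonneg (by positivity)) hG.le
    linarith

/-- The value of the principal value distribution on `φ̂` as an absolutely convergent integral. -/
theorem integral_kernelSymbol_mul (hd : 0 < d) {p : MvPolynomial (Fin d) ℂ}
    (hp : p.IsHomogeneous 2) (hc : CancellationCondition p)
    (φ ψ : SchwartzMap (EuclideanSpace ℝ (Fin d)) ℂ)
    (hψ : ∀ x, fourierPlus (fun y => φ y) x = ψ x) :
    ∫ ξ, kernelSymbol p ξ * φ ξ =
      ∫ x, kernelK p x * (ψ x - if ‖x‖ ≤ 1 then ψ 0 else 0) := by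
  have : Nonempty (Fin d) := ⟨⟨0, hd⟩⟩
  obtain ⟨C, hC0, hC⟩ := exists_norm_polyAt_le hp
  obtain ⟨C', hC0', hC'⟩ := exists_norm_kernelSymbol_le hp
  have hG : 0 < Real.Gamma ((d : ℝ) / 2 + 1) := Real.Gamma_pos_of_pos (by positivity)
  have heq : ∀ T : ℝ, 0 < T →
      ∫ ξ, kernelSymbol p ξ * ((Real.exp (-‖ξ‖ ^ 2 / (4 * T)) : ℝ) : ℂ) * φ ξ =
      ∫ x, (ewaldCutoff d T ‖x‖ : ℂ) *
        (kernelK p x * (ψ x - if ‖x‖ ≤ 1 then ψ 0 else 0)) := by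
    intro T hT
    rw [integral_kernelSymbol_mul_eq_fourierPlus hd hp hc hT φ.integrable,
      ← integral_kernelK_mul_radial_mul hd hp hc ψ (w := ewaldCutoff d T)
        (M := C * (T ^ ((d : ℝ) / 2) * T / Real.Gamma ((d : ℝ) / 2 + 1)))]
    · refine integral_congr_ae (.of_forall fun x => ?_)
      simp only
      rw [kernelK_mul_ewaldCutoff hp, hψ]
    · have := measurable_lowerWeight d T
      unfold ewaldCutoff
      fun_prop
    · exact fun r hr => norm_ewaldCutoff_le d hT hr
    · intro x hx
      rw [kernelK_mul_ewaldCutoff hp, norm_mul, Complex.norm_real,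
        Real.norm_of_nonneg (div_nonneg (lowerWeight_nonneg d T _) hG.le)]
      gcongr
      · exact div_nonneg (lowerWeight_nonneg d T _) hG.le
      · exact (hC x).trans (mul_le_of_le_one_right hC0 (pow_le_one₀ (norm_nonneg _) hx))
      · exact lowerWeight_le d hT (by positivity)
    · refine ((ψ.integrable_pow_mul volume 2).const_mul C).mono'
        ((continuous_polyAt p).aestronglyMeasurable.mul ?_) (.of_forall fun x => ?_)
      · exact (funext hψ ▸ ψ.continuous).aestronglyMeasurable
      · rw [hψ, norm_mul, ← mul_assoc]
        gcongr
        exact hC x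
  -- Both sides are limits of the damped identity as `T → ∞`, by dominated convergence.
  refine tendsto_nhds_unique (f := fun T : ℝ =>
    ∫ ξ, kernelSymbol p ξ * ((Real.exp (-‖ξ‖ ^ 2 / (4 * T)) : ℝ) : ℂ) * φ ξ) (l := atTop) ?_ ?_
  · refine tendsto_integral_filter_of_dominated_convergence (fun ξ => C' * ‖φ ξ‖) ?_ ?_
      (φ.integrable.norm.const_mul _) (.of_forall fun ξ => ?_)
    · refine .of_forall fun T => ((measurable_kernelSymbol p).aestronglyMeasurable.mul ?_).mul
        φ.continuous.aestronglyMeasurable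
      exact (by fun_prop : Continuous _).aestronglyMeasurable
    · filter_upwards [eventually_gt_atTop 0] with T hT
      refine .of_forall fun ξ => ?_
      rw [norm_mul, norm_mul, Complex.norm_real, Real.norm_of_nonneg (Real.exp_pos _).le]
      have h1 : Real.exp (-‖ξ‖ ^ 2 / (4 * T)) ≤ 1 := by
        rw [Real.exp_le_one_iff]
        exact div_nonpos_of_nonpos_of_nonneg (by simp) (by positivity)
      have h2 := mul_le_mul (hC' ξ) h1 (Real.exp_pos _).le hC0'
      rw [mul_one] at h2
      gcongr
    · have h1 : Tendsto (fun T : ℝ => -‖ξ‖ ^ 2 / (4 * T)) atTop (𝓝 0) :=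
        tendsto_const_nhds.div_atTop (tendsto_id.const_mul_atTop (by norm_num))
      have h2 := (Complex.continuous_ofReal.tendsto _).comp
        ((Real.continuous_exp.tendsto _).comp h1)
      rw [Real.exp_zero, Complex.ofReal_one] at h2
      have h3 := (h2.const_mul (kernelSymbol p ξ)).mul_const (φ ξ)
      rwa [mul_one] at h3
  · have hint := integrable_kernelK_mul_sub hd hp ψ
    refine Tendsto.congr' (f₁ := fun T : ℝ => ∫ x, (ewaldCutoff d T ‖x‖ : ℂ) *
      (kernelK p x * (ψ x - if ‖x‖ ≤ 1 then ψ 0 else 0))) ?_ ?_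
    · filter_upwards [eventually_gt_atTop 0] with T hT
      exact (heq T hT).symm
    refine tendsto_integral_filter_of_dominated_convergence _ ?_ ?_ hint.norm
      (.of_forall fun x => ?_)
    · refine .of_forall fun T => (Measurable.aestronglyMeasurable ?_).mul hint.aestronglyMeasurable
      have := measurable_lowerWeight d T
      unfold ewaldCutoff
      fun_prop
    · filter_upwards [eventually_gt_atTop 0] with T hT
      refine .of_forall fun x => ?_
      rw [norm_mul]
      refine mul_le_of_le_one_left (norm_nonneg _) ?_
      simpa using norm_ewaldCutoff_le d hT (norm_nonneg x)
    · rcases eq_or_ne x 0 with rfl | hx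
      · simp [kernelK_zero hp]
      have hx' : 0 < ‖x‖ := norm_pos_iff.2 hx
      have h1 := ((tendsto_upperGamma d (s := ‖x‖ ^ 2) (by positivity)).div_const
        (Real.Gamma ((d : ℝ) / 2 + 1))).const_sub 1
      rw [zero_div, sub_zero] at h1
      have h2 : Tendsto (fun T => ewaldCutoff d T ‖x‖) atTop (𝓝 1) := by
        refine h1.congr' ?_
        filter_upwards [eventually_gt_atTop 0] with T hT
        exact (ewaldCutoff_eq d hT hx').symm
      have h3 := ((Complex.continuous_ofReal.tendsto _).comp h2).mul_const
        (kernelK p x * (ψ x - if ‖x‖ ≤ 1 then ψ 0 else 0))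
      rwa [Complex.ofReal_one, one_mul] at h3

theorem isKernelSymbol_kernelSymbol (hd : 0 < d) {p : MvPolynomial (Fin d) ℂ}
    (hp : p.IsHomogeneous 2) (hc : CancellationCondition p) :
    IsKernelSymbol p (kernelSymbol p) := by
  refine ⟨(exists_norm_kernelSymbol_le hp).imp fun C h => h.2, continuousOn_kernelSymbol p,
    fun φ => ?_⟩
  obtain ⟨ψ, hψ⟩ := exists_schwartz_fourierPlus φ
  obtain ⟨C, hC0, hC⟩ := exists_norm_kernelK_le hp
  rw [integral_kernelSymbol_mul hd hp hc φ ψ hψ]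
  have hint := integrable_kernelK_mul_sub hd hp ψ
  have heq : ∀ ε : ℝ, 0 < ε →
      ∫ x in {x : EuclideanSpace ℝ (Fin d) | ε < ‖x‖}, kernelK p x * fourierPlus (fun y => φ y) x =
      ∫ x, (((if ε < ‖x‖ then 1 else 0 : ℝ)) : ℂ) *
        (kernelK p x * (ψ x - if ‖x‖ ≤ 1 then ψ 0 else 0)) := by
    intro ε hε
    rw [← integral_kernelK_mul_radial_mul hd hp hc ψ (w := fun r => if ε < r then 1 else 0)
      (M := C / ε ^ d), ← integral_indicator (measurableSet_lt measurable_const measurable_norm)]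
    · refine integral_congr_ae (.of_forall fun x => ?_)
      by_cases hx : ε < ‖x‖ <;> simp [Set.indicator, hx, hψ]
    · exact Measurable.ite measurableSet_Ioi measurable_const measurable_const
    · intro r _
      split_ifs <;> simp
    · intro x _
      by_cases hx : ε < ‖x‖
      · simp only [hx, if_true, Complex.ofReal_one, mul_one]
        refine (hC x).trans ?_
        gcongr
      · simp only [hx, if_false, Complex.ofReal_zero, mul_zero, norm_zero]
        positivity
  refine Tendsto.congr' (f₁ := fun ε : ℝ => ∫ x, (((if ε < ‖x‖ then 1 else 0 : ℝ)) : ℂ) *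
        (kernelK p x * (ψ x - if ‖x‖ ≤ 1 then ψ 0 else 0))) ?_ ?_
  · filter_upwards [self_mem_nhdsWithin] with ε hε
    exact (heq ε hε).symm
  refine tendsto_integral_filter_of_dominated_convergence _ ?_ ?_ hint.norm
    (.of_forall fun x => ?_)
  · refine .of_forall fun ε => (Measurable.aestronglyMeasurable ?_).mul hint.aestronglyMeasurable
    exact Complex.measurable_ofReal.comp (Measurable.ite
      (measurableSet_lt measurable_const measurable_norm) measurable_const measurable_const)
  · refine .of_forall fun ε => .of_forall fun x => ?_
    rw [norm_mul]
    refine mul_le_of_le_one_left (norm_nonneg _) ?_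
    split_ifs <;> simp
  · rcases eq_or_ne x 0 with rfl | hx
    · simp [kernelK_zero hp]
    refine tendsto_const_nhds.congr' ?_
    filter_upwards [Ioo_mem_nhdsGT (norm_pos_iff.2 hx)] with ε hε
    simp [hε.2]

/-- The Fourier transform of the principal value distribution is determined away from the
origin. -/
theorem IsKernelSymbol.eq_kernelSymbol (hd : 0 < d) {p : MvPolynomial (Fin d) ℂ}
    (hp : p.IsHomogeneous 2) (hc : CancellationCondition p)
    {Khat : EuclideanSpace ℝ (Fin d) → ℂ} (h : IsKernelSymbol p Khat)
    {ξ : EuclideanSpace ℝ (Fin d)} (hξ : ξ ≠ 0) : Khat ξ = kernelSymbol p ξ := by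
  have : Nonempty (Fin d) := ⟨⟨0, hd⟩⟩
  have h0 := isKernelSymbol_kernelSymbol hd hp hc
  have hloc : ∀ f : EuclideanSpace ℝ (Fin d) → ℂ, IsKernelSymbol p f → LocallyIntegrable f := by
    intro f hf
    obtain ⟨C, hC⟩ := hf.bounded
    have hm := hf.continuousOn.aestronglyMeasurable (μ := volume) (measurableSet_singleton 0).compl
    rw [restrict_compl_singleton] at hm
    refine (locallyIntegrable_const C).mono hm (.of_forall fun x => ?_)
    exact (hC x).trans (le_abs_self C)
  have hae := ae_eq_of_integral_contDiff_smul_eq (hloc _ h) (hloc _ h0) fun g hg hgs => by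
    let φ : SchwartzMap (EuclideanSpace ℝ (Fin d)) ℂ :=
      (hgs.comp_left (g := ((↑) : ℝ → ℂ)) Complex.ofReal_zero).toSchwartzMap
        (Complex.ofRealCLM.contDiff.comp hg)
    have h1 := tendsto_nhds_unique (h.fourier_pv φ) (h0.fourier_pv φ)
    have e : ∀ f : EuclideanSpace ℝ (Fin d) → ℂ, ∫ x, g x • f x = ∫ x, f x * φ x := fun f =>
      integral_congr_ae (.of_forall fun x => by
        change g x • f x = f x * (g x : ℂ)
        rw [Complex.real_smul, mul_comm])
    rw [e, e, h1]
  exact Measure.eqOn_open_of_ae_eq (ae_restrict_of_ae hae) isOpen_compl_singleton h.continuousOn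
    h0.continuousOn hξ

/-! ### Series of exponentials are analytic -/

theorem summable_prod_pi {f : ℤ → ℝ} (hf0 : ∀ m, 0 ≤ f m) (hf : Summable f) (d : ℕ) :
    Summable fun m : Fin d → ℤ => ∏ j, f (m j) := by
  induction d with
  | zero => exact Summable.of_finite
  | succ d ih =>
    rw [← (Fin.consEquiv fun _ : Fin (d + 1) => ℤ).summable_iff]
    refine (hf.mul_of_nonneg ih hf0 fun m => Finset.prod_nonneg fun j _ => hf0 _).congr fun z => ?_
    simp [Fin.prod_univ_succ]

theorem summable_exp_neg_mul_norm_sq (d : ℕ) {c : ℝ} (hc : 0 < c) :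
    Summable fun m : Fin d → ℤ => Real.exp (-c * ‖latticePt m‖ ^ 2) := by
  have h1 : Summable fun m : ℤ => Real.exp (-c * (m : ℝ) ^ 2) := by
    have hnat : Summable fun n : ℕ => Real.exp (-c * (n : ℝ) ^ 2) := by
      refine Summable.of_nonneg_of_le (fun n => (Real.exp_pos _).le) (fun n => ?_)
        (summable_geometric_of_lt_one (Real.exp_pos (-c)).le (Real.exp_lt_one_iff.2 (by linarith)))
      rw [← Real.exp_nat_mul]
      refine Real.exp_le_exp.2 ?_
      have : (n : ℝ) ≤ (n : ℝ) ^ 2 := by exact_mod_cast Nat.le_self_pow two_ne_zero n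
      nlinarith
    refine Summable.of_nat_of_neg ?_ ?_ <;> simpa using hnat
  refine (summable_prod_pi (fun m => (Real.exp_pos _).le) h1 d).congr fun m => ?_
  rw [← Real.exp_sum, norm_latticePt_sq, Finset.mul_sum]

/-- Gaussian decay beats every exponential rate, by completing the square. -/
theorem summable_exp_mul_norm_sub (d : ℕ) {c : ℝ} (hc : 0 < c) (r : ℝ) :
    Summable fun m : Fin d → ℤ => Real.exp (r * ‖latticePt m‖ - c * ‖latticePt m‖ ^ 2) := by
  refine Summable.of_nonneg_of_le (fun m => (Real.exp_pos _).le) (fun m => ?_)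
    ((summable_exp_neg_mul_norm_sq d (half_pos hc)).mul_left (Real.exp (r ^ 2 / (2 * c))))
  rw [← Real.exp_add]
  refine Real.exp_le_exp.2 ?_
  have h : r ^ 2 / (2 * c) + -(c / 2) * ‖latticePt m‖ ^ 2 - (r * ‖latticePt m‖ -
      c * ‖latticePt m‖ ^ 2) = (r - c * ‖latticePt m‖) ^ 2 / (2 * c) := by
    field_simp
    ring
  have : 0 ≤ (r - c * ‖latticePt m‖) ^ 2 / (2 * c) := by positivity
  linarith

section ExponentialSeries

variable {ι E B : Type*} [NormedAddCommGroup E] [NormedSpace ℝ E] [NormedAddCommGroup B]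
  [NormedSpace ℂ B] [NormedSpace ℝ B] [IsScalarTower ℝ ℂ B]

/-- The `k`-th term of the Taylor expansion of `y ↦ e^{L y} • b` as a multilinear map. -/
def expTaylorTerm (L : E →L[ℝ] ℂ) (b : B) (k : ℕ) :
    ContinuousMultilinearMap ℝ (fun _ : Fin k => E) B :=
  ((ContinuousLinearMap.toSpanSingleton ℂ ((k.factorial : ℂ)⁻¹ • b)).restrictScalars
    ℝ).compContinuousMultilinearMap
      ((ContinuousMultilinearMap.mkPiAlgebraFin ℝ k ℂ).compContinuousLinearMap fun _ => L)

theorem expTaylorTerm_apply (L : E →L[ℝ] ℂ) (b : B) (k : ℕ) (y : E) :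
    expTaylorTerm L b k (fun _ => y) = ((k.factorial : ℂ)⁻¹ * L y ^ k) • b := by
  simp [expTaylorTerm, List.ofFn_const, smul_smul, mul_comm]

theorem norm_expTaylorTerm_le (L : E →L[ℝ] ℂ) (b : B) (k : ℕ) :
    ‖expTaylorTerm L b k‖ ≤ ‖L‖ ^ k / k.factorial * ‖b‖ := by
  refine ContinuousMultilinearMap.opNorm_le_bound (by positivity) fun v => ?_
  have h1 : expTaylorTerm L b k v =
      (List.ofFn fun i => L (v i)).prod • (k.factorial : ℂ)⁻¹ • b := by
    simp [expTaylorTerm]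
  rw [h1, norm_smul, norm_smul, norm_inv, List.prod_ofFn, norm_prod, Complex.norm_natCast]
  have h2 : ∏ i, ‖L (v i)‖ ≤ ‖L‖ ^ k * ∏ i, ‖v i‖ := by
    calc ∏ i, ‖L (v i)‖ ≤ ∏ i, (‖L‖ * ‖v i‖) :=
          Finset.prod_le_prod (fun i _ => norm_nonneg _) fun i _ => L.le_opNorm _
      _ = _ := by simp [Finset.prod_mul_distrib]
  calc (∏ i, ‖L (v i)‖) * ((k.factorial : ℝ)⁻¹ * ‖b‖)
      ≤ (‖L‖ ^ k * ∏ i, ‖v i‖) * ((k.factorial : ℝ)⁻¹ * ‖b‖) := by gcongr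
    _ = _ := by ring

/-- A series of exponentials whose coefficients decay faster than any exponential rate of the
frequencies is real-analytic. -/
theorem analyticAt_tsum_exp [CompleteSpace B] (L : ι → E →L[ℝ] ℂ) (a : ι → B)
    (h : ∀ r : ℝ, Summable fun i => Real.exp (r * ‖L i‖) * ‖a i‖) (x : E) :
    AnalyticAt ℝ (fun y => ∑' i, Complex.exp (L i y) • a i) x := by
  -- Recentring at `x` only changes the coefficients by factors of modulus at most `e^{‖x‖ ‖L i‖}`.
  let b : ι → B := fun i => Complex.exp (L i x) • a i
  have hexp : ∀ i (y : E), ‖Complex.exp (L i y)‖ ≤ Real.exp (‖y‖ * ‖L i‖) := fun i y => by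
    rw [Complex.norm_exp]
    refine Real.exp_le_exp.2 (((Complex.re_le_norm _).trans ((L i).le_opNorm y)).trans_eq ?_)
    ring
  have hb : Summable fun i => Real.exp ‖L i‖ * ‖b i‖ := by
    refine Summable.of_nonneg_of_le (fun i => by positivity) (fun i => ?_) (h (1 + ‖x‖))
    rw [norm_smul, ← mul_assoc, add_mul, Real.exp_add, one_mul]
    gcongr
    exact hexp i x
  have hsum : ∀ i, HasSum (fun k : ℕ => ‖L i‖ ^ k / k.factorial * ‖b i‖)
      (Real.exp ‖L i‖ * ‖b i‖) := fun i => by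
    have := NormedSpace.expSeries_div_hasSum_exp (𝔸 := ℝ) ‖L i‖
    rw [← Real.exp_eq_exp_ℝ] at this
    exact this.mul_right _
  -- The Taylor coefficients are summable jointly in `i` and `k`, so the two sums can be exchanged.
  have hprod : Summable fun z : ι × ℕ => ‖L z.1‖ ^ z.2 / z.2.factorial * ‖b z.1‖ := by
    rw [summable_prod_of_nonneg fun z => by positivity]
    refine ⟨fun i => (hsum i).summable, ?_⟩
    simpa only [fun i => (hsum i).tsum_eq] using hb
  have hT : ∀ k, Summable fun i => expTaylorTerm (L i) (b i) k := fun k =>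
    Summable.of_norm_bounded (hprod.prod_symm.prod_factor k) fun i =>
      norm_expTaylorTerm_le (L i) (b i) k
  refine ⟨fun k => ∑' i, expTaylorTerm (L i) (b i) k, 1, ?_, one_pos, fun {y} hy => ?_⟩
  · refine FormalMultilinearSeries.le_radius_of_bound (r := 1) _
      (∑' z : ι × ℕ, ‖L z.1‖ ^ z.2 / z.2.factorial * ‖b z.1‖) fun k => ?_
    simp only [NNReal.coe_one, one_pow, mul_one]
    refine (tsum_of_norm_bounded (hprod.prod_symm.prod_factor k).hasSum
      fun i => norm_expTaylorTerm_le (L i) (b i) k).trans ?_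
    exact Summable.tsum_le_tsum_of_inj (fun i => (i, k)) (fun i j hij => (Prod.ext_iff.1 hij).1)
      (fun z _ => by positivity) (fun i => le_rfl) (hprod.prod_symm.prod_factor k) hprod
  · have hy1 : ‖y‖ ≤ 1 := by
      have h1 : ‖y‖ₑ < 1 := by simpa using hy
      rw [← ofReal_norm] at h1
      exact (ENNReal.ofReal_lt_one.1 h1).le
    have hterm : Summable fun z : ι × ℕ => expTaylorTerm (L z.1) (b z.1) z.2 fun _ => y := by
      refine Summable.of_norm_bounded hprod fun z => ?_
      refine (ContinuousMultilinearMap.le_opNorm _ _).trans ?_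
      simp only [Finset.prod_const, Finset.card_univ, Fintype.card_fin]
      exact (mul_le_of_le_one_right (norm_nonneg _) (pow_le_one₀ (norm_nonneg _) hy1)).trans
        (norm_expTaylorTerm_le _ _ _)
    have hfib : ∀ i, HasSum (fun k : ℕ => expTaylorTerm (L i) (b i) k fun _ => y)
        (Complex.exp (L i (x + y)) • a i) := fun i => by
      have h1 := (NormedSpace.expSeries_div_hasSum_exp (𝔸 := ℂ) (L i y)).smul_const (b i)
      rw [← Complex.exp_eq_exp_ℂ] at h1
      have h2 : Complex.exp (L i (x + y)) • a i = Complex.exp (L i y) • b i := by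
        rw [map_add, Complex.exp_add, mul_comm, mul_smul]
      rw [h2]
      refine h1.congr_fun fun k => ?_
      rw [expTaylorTerm_apply, div_eq_inv_mul]
    have htot := hterm.hasSum
    have h1 := htot.prod_fiberwise hfib
    have h2 := (Equiv.prodComm ℕ ι).hasSum_iff.2 htot
    have h3 := h2.prod_fiberwise (f := _)
      (g := fun k => ∑' i, expTaylorTerm (L i) (b i) k fun _ => y)
      fun k => (hterm.prod_symm.prod_factor k).hasSum
    rw [h1.tsum_eq]
    refine h3.congr_fun fun k => ?_
    exact ContinuousMultilinearMap.tsum_eval (hT k) _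

end ExponentialSeries

/-! ### Bounds and analyticity of the two lattice sums -/

theorem one_le_norm_latticePt {m : Fin d → ℤ} (hm : m ≠ 0) : 1 ≤ ‖latticePt m‖ := by
  obtain ⟨j, hj⟩ := Function.ne_iff.1 hm
  refine le_trans ?_ (PiLp.norm_apply_le (latticePt m) j)
  rw [latticePt_apply, Real.norm_eq_abs]
  exact_mod_cast Int.one_le_abs hj

theorem latticePt_zero : latticePt (0 : Fin d → ℤ) = 0 := by
  ext j
  simp [latticePt_apply]

/-- Coordinatewise, `|τⱼ| ≤ π` gives `|τⱼ + 2πnⱼ| ≥ π |nⱼ|`. -/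
theorem pi_mul_norm_le_norm_add {τ : EuclideanSpace ℝ (Fin d)} (hτ : τ ∈ periodCube d)
    (n : Fin d → ℤ) :
    Real.pi * ‖latticePt n‖ ≤ ‖τ + (2 * Real.pi) • latticePt n‖ := by
  have hpi := Real.pi_pos
  rw [← sq_le_sq₀ (by positivity) (by positivity), mul_pow, norm_latticePt_sq,
    EuclideanSpace.norm_sq_eq, Finset.mul_sum]
  refine Finset.sum_le_sum fun j _ => ?_
  rw [← mul_pow, Real.norm_eq_abs, sq_abs, sq_le_sq]
  simp only [PiLp.add_apply, PiLp.smul_apply, latticePt_apply, smul_eq_mul]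
  rcases eq_or_ne (n j) 0 with h0 | h0
  · simp [h0]
  have h1 : (1 : ℝ) ≤ |(n j : ℝ)| := by exact_mod_cast Int.one_le_abs h0
  have h2 : |τ j| ≤ Real.pi := abs_le.2 (hτ j)
  have h3 : |2 * Real.pi * (n j : ℝ)| ≤ |τ j + 2 * Real.pi * n j| + |τ j| := by
    have := abs_sub (τ j + 2 * Real.pi * n j) (τ j)
    simpa using this
  rw [abs_mul, abs_of_pos (by positivity : 0 < 2 * Real.pi)] at h3
  rw [abs_mul, abs_of_pos hpi]
  nlinarith

theorem exists_norm_kernelK_latticePt_le {p : MvPolynomial (Fin d) ℂ} (hp : p.IsHomogeneous 2) :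
    ∃ C : ℝ, 0 ≤ C ∧ ∀ m : Fin d → ℤ, ‖kernelK p (latticePt m)‖ ≤ C := by
  obtain ⟨C, hC0, hC⟩ := exists_norm_kernelK_le hp
  refine ⟨C, hC0, fun m => ?_⟩
  rcases eq_or_ne m 0 with rfl | hm
  · rw [latticePt_zero, kernelK_zero hp, norm_zero]
    exact hC0
  · exact (hC _).trans (div_le_self hC0 (one_le_pow₀ (one_le_norm_latticePt hm)))

theorem norm_latticeExp (m : Fin d → ℤ) (τ : EuclideanSpace ℝ (Fin d)) : ‖latticeExp m τ‖ = 1 := by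
  rw [latticeExp, mul_comm, Complex.norm_exp_ofReal_mul_I]

theorem exists_norm_ewaldFourierTerm_le {p : MvPolynomial (Fin d) ℂ} (hp : p.IsHomogeneous 2)
    (β : ℝ) : ∃ C : ℝ, 0 ≤ C ∧ ∀ (m : Fin d → ℤ) (τ : EuclideanSpace ℝ (Fin d)),
      ‖ewaldFourierTerm p β m τ‖ ≤ C * Real.exp (-(β ^ 2 / 2) * ‖latticePt m‖ ^ 2) := by
  obtain ⟨C, hC0, hC⟩ := exists_norm_kernelK_latticePt_le hp
  obtain ⟨D, hD0, hD⟩ := exists_upperGamma_le d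
  have hG : 0 < Real.Gamma ((d : ℝ) / 2 + 1) := Real.Gamma_pos_of_pos (by positivity)
  refine ⟨C * (D / Real.Gamma ((d : ℝ) / 2 + 1)), by positivity, fun m τ => ?_⟩
  rw [ewaldFourierTerm, norm_mul, norm_mul, norm_latticeExp, mul_one, Complex.norm_real,
    Real.norm_of_nonneg (div_nonneg (upperGamma_nonneg (by positivity)) hG.le), mul_assoc]
  gcongr
  · exact div_nonneg (upperGamma_nonneg (by positivity)) hG.le
  · exact hC m
  · rw [div_mul_eq_mul_div]
    gcongr
    refine (hD _ (by positivity)).trans (le_of_eq ?_)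
    congr 2
    ring

theorem analyticAt_tsum_ewaldFourierTerm {p : MvPolynomial (Fin d) ℂ} (hp : p.IsHomogeneous 2)
    {β : ℝ} (hβ : 0 < β) (τ : EuclideanSpace ℝ (Fin d)) :
    AnalyticAt ℝ (fun τ => ∑' m : Fin d → ℤ, ewaldFourierTerm p β m τ) τ := by
  obtain ⟨C, hC0, hC⟩ := exists_norm_ewaldFourierTerm_le hp β
  let L : (Fin d → ℤ) → EuclideanSpace ℝ (Fin d) →L[ℝ] ℂ := fun m =>
    Complex.I • (Complex.ofRealCLM.comp (innerSL ℝ (latticePt m)))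
  have hL : ∀ m, ‖L m‖ ≤ ‖latticePt m‖ := fun m => by
    refine ContinuousLinearMap.opNorm_le_bound _ (norm_nonneg _) fun y => ?_
    simpa [L] using abs_real_inner_le_norm (latticePt m) y
  have h := analyticAt_tsum_exp L (fun m => ewaldFourierTerm p β m 0) (fun r => ?_) τ
  · refine h.congr (.of_forall fun y => tsum_congr fun m => ?_)
    simp [ewaldFourierTerm, latticeExp, L, mul_comm]
  · refine Summable.of_nonneg_of_le (fun m => by positivity) (fun m => ?_)
      ((summable_exp_mul_norm_sub d (c := β ^ 2 / 2) (by positivity) |r|).mul_left C)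
    have h1 : Real.exp (r * ‖L m‖) ≤ Real.exp (|r| * ‖latticePt m‖) := by
      refine Real.exp_le_exp.2 ?_
      exact mul_le_mul (le_abs_self r) (hL m) (norm_nonneg _) (abs_nonneg r)
    calc Real.exp (r * ‖L m‖) * ‖ewaldFourierTerm p β m 0‖
        ≤ Real.exp (|r| * ‖latticePt m‖) * (C * Real.exp (-(β ^ 2 / 2) * ‖latticePt m‖ ^ 2)) := by
          gcongr
          exact hC m 0
      _ = C * Real.exp (|r| * ‖latticePt m‖ - β ^ 2 / 2 * ‖latticePt m‖ ^ 2) := by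
          rw [sub_eq_add_neg, Real.exp_add, neg_mul]
          ring

/-- A series of exponentials stays analytic when its terms are multiplied by the coordinates
`ev i (b y)` of a vector `b y` depending analytically on `y`, with `ev` a bounded family of
functionals: the series is then the pairing of an analytic family of functionals with an analytic
family of vectors. -/
theorem analyticAt_tsum_exp_mul {ι E V : Type*} [NormedAddCommGroup E] [NormedSpace ℝ E]
    [NormedAddCommGroup V] [NormedSpace ℂ V] [NormedSpace ℝ V] [IsScalarTower ℝ ℂ V]
    (L : ι → E →L[ℝ] ℂ) (a : ι → ℂ)
    (h : ∀ r : ℝ, Summable fun i => Real.exp (r * ‖L i‖) * ‖a i‖) {ev : ι → V →L[ℂ] ℂ}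
    (hev : ∀ i, ‖ev i‖ ≤ 1) {b : E → V} {x : E} (hb : AnalyticAt ℝ b x) :
    AnalyticAt ℝ (fun y => ∑' i, Complex.exp (L i y) * a i * ev i (b y)) x := by
  have h' : ∀ r : ℝ, Summable fun i => Real.exp (r * ‖L i‖) * ‖a i • ev i‖ := fun r => by
    refine Summable.of_nonneg_of_le (fun i => by positivity) (fun i => ?_) (h r)
    rw [norm_smul]
    gcongr
    exact mul_le_of_le_one_right (norm_nonneg _) (hev i)
  have hΛ : AnalyticAt ℝ (fun y => ∑' i, Complex.exp (L i y) • a i • ev i) x :=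
    analyticAt_tsum_exp L (fun i => a i • ev i) h' x
  have hΛ' : AnalyticAt ℝ (fun y => ContinuousLinearMap.restrictScalarsL ℂ V ℂ ℝ ℝ
      (∑' i, Complex.exp (L i y) • a i • ev i)) x :=
    ((ContinuousLinearMap.restrictScalarsL ℂ V ℂ ℝ ℝ).analyticAt _).fun_comp hΛ
  refine (((ContinuousLinearMap.id ℝ (V →L[ℝ] ℂ)).analyticAt_bilinear _).comp₂ hΛ' hb).congr
    (.of_forall fun y => ?_)
  have hs : Summable fun i => Complex.exp (L i y) • a i • ev i := by
    refine Summable.of_norm_bounded (h' ‖y‖) fun i => ?_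
    rw [norm_smul]
    gcongr
    rw [Complex.norm_exp]
    refine Real.exp_le_exp.2 (((Complex.re_le_norm _).trans ((L i).le_opNorm y)).trans_eq ?_)
    ring
  have h2 := hs.hasSum.mapL (ContinuousLinearMap.apply ℂ ℂ (b y))
  refine (h2.tsum_eq.symm).trans (tsum_congr fun i => ?_)
  simp [mul_assoc]

theorem norm_add_lattice_sq (τ : EuclideanSpace ℝ (Fin d)) (n : Fin d → ℤ) :
    ‖τ + (2 * Real.pi) • latticePt n‖ ^ 2 =
      ‖τ‖ ^ 2 + 4 * Real.pi * inner ℝ (latticePt n) τ + 4 * Real.pi ^ 2 * ‖latticePt n‖ ^ 2 := by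
  rw [norm_add_sq_real, inner_smul_right, real_inner_comm, norm_smul, Real.norm_of_nonneg
    (by positivity)]
  ring

open scoped BoundedContinuousFunction in
/-- The symbol at the translates `τ + 2πn`, `n ≠ 0`, is an analytic family of bounded functions of
`n`: numerator and denominator, divided by `|n|²`, are polynomial in `τ` with values in the Banach
algebra of bounded functions, and the denominator is invertible there. -/
theorem exists_analyticAt_quotient {p : MvPolynomial (Fin d) ℂ} (hp : p.IsHomogeneous 2)
    {τ₀ : EuclideanSpace ℝ (Fin d)} (hτ₀ : τ₀ ∈ periodCube d) :
    ∃ b : EuclideanSpace ℝ (Fin d) → ({n : Fin d → ℤ // n ≠ 0} →ᵇ ℂ), AnalyticAt ℝ b τ₀ ∧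
      ∀ᶠ τ in 𝓝 τ₀, ∀ n : {n : Fin d → ℤ // n ≠ 0}, b τ n =
        polyAt p (τ + (2 * Real.pi) • latticePt n.1) /
          ((‖τ + (2 * Real.pi) • latticePt n.1‖ ^ 2 : ℝ) : ℂ) := by
  obtain ⟨A, hA⟩ := exists_quadraticForm hp
  have hn0 : ∀ n : {n : Fin d → ℤ // n ≠ 0}, 0 < ‖latticePt n.1‖ := fun n =>
    one_pos.trans_le (one_le_norm_latticePt n.2)
  let b₀ : {n : Fin d → ℤ // n ≠ 0} →ᵇ ℂ :=
    BoundedContinuousFunction.ofNormedAddCommGroupDiscrete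
      (fun n => ((‖latticePt n.1‖⁻¹ : ℝ) : ℂ)) 1 fun n => by
        rw [Complex.norm_real, norm_inv, norm_norm]
        exact inv_le_one_of_one_le₀ (one_le_norm_latticePt n.2)
  let c : Fin d → ({n : Fin d → ℤ // n ≠ 0} →ᵇ ℂ) := fun j =>
    BoundedContinuousFunction.ofNormedAddCommGroupDiscrete
      (fun n => ((2 * Real.pi * n.1 j * ‖latticePt n.1‖⁻¹ : ℝ) : ℂ)) (2 * Real.pi) fun n => by
        have h1 : |(n.1 j : ℝ)| ≤ ‖latticePt n.1‖ := by
          simpa [latticePt_apply] using PiLp.norm_apply_le (latticePt n.1) j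
        rw [Complex.norm_real, norm_mul, norm_mul, norm_inv, norm_norm, mul_assoc,
          Real.norm_of_nonneg (by positivity : 0 ≤ 2 * Real.pi), ← div_eq_mul_inv]
        exact mul_le_of_le_one_right (by positivity) ((div_le_one (hn0 n)).2 h1)
  -- `u j τ` is the bounded function `n ↦ (τ + 2πn)ⱼ / |n|`, affine in `τ`.
  let u : Fin d → EuclideanSpace ℝ (Fin d) → ({n : Fin d → ℤ // n ≠ 0} →ᵇ ℂ) := fun j τ =>
    τ j • b₀ + c j
  have hu : ∀ j τ n, u j τ n = (((τ + (2 * Real.pi) • latticePt n.1) j : ℝ) : ℂ) *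
      ((‖latticePt n.1‖⁻¹ : ℝ) : ℂ) := fun j τ n => by
    simp [u, b₀, c, latticePt_apply]
    ring
  have hua : ∀ j, AnalyticAt ℝ (u j) τ₀ := fun j =>
    (((EuclideanSpace.proj j : EuclideanSpace ℝ (Fin d) →L[ℝ] ℝ).analyticAt τ₀).smul
      analyticAt_const).add analyticAt_const
  let q : EuclideanSpace ℝ (Fin d) → ({n : Fin d → ℤ // n ≠ 0} →ᵇ ℂ) := fun τ =>
    ∑ j, u j τ * u j τ
  let P : EuclideanSpace ℝ (Fin d) → ({n : Fin d → ℤ // n ≠ 0} →ᵇ ℂ) := fun τ =>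
    ∑ j, ∑ k, A j k • (u j τ * u k τ)
  have hq : ∀ τ n, q τ n = ((‖τ + (2 * Real.pi) • latticePt n.1‖ ^ 2 : ℝ) : ℂ) *
      ((‖latticePt n.1‖⁻¹ ^ 2 : ℝ) : ℂ) := fun τ n => by
    rw [EuclideanSpace.norm_sq_eq]
    simp only [q, BoundedContinuousFunction.coe_sum, Finset.sum_apply,
      BoundedContinuousFunction.mul_apply, hu, Real.norm_eq_abs, sq_abs]
    rw [Complex.ofReal_sum, Finset.sum_mul]
    refine Finset.sum_congr rfl fun j _ => ?_
    push_cast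
    ring
  have hP : ∀ τ n, P τ n = polyAt p (τ + (2 * Real.pi) • latticePt n.1) *
      ((‖latticePt n.1‖⁻¹ ^ 2 : ℝ) : ℂ) := fun τ n => by
    rw [hA, Finset.sum_mul]
    simp only [P, BoundedContinuousFunction.coe_sum, Finset.sum_apply,
      BoundedContinuousFunction.mul_apply, BoundedContinuousFunction.smul_apply, hu, smul_eq_mul]
    refine Finset.sum_congr rfl fun j _ => ?_
    rw [Finset.sum_mul]
    refine Finset.sum_congr rfl fun k _ => ?_
    push_cast
    ring
  have hqa : AnalyticAt ℝ q τ₀ :=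
    Finset.analyticAt_fun_sum _ fun j _ => (hua j).mul (hua j)
  have hPa : AnalyticAt ℝ P τ₀ :=
    Finset.analyticAt_fun_sum _ fun j _ => Finset.analyticAt_fun_sum _ fun k _ =>
      ((hua j).mul (hua k)).fun_const_smul
  have hlow : ∀ n : {n : Fin d → ℤ // n ≠ 0}, Real.pi ^ 2 ≤ ‖q τ₀ n‖ := fun n => by
    rw [hq, norm_mul, Complex.norm_real, Complex.norm_real, Real.norm_of_nonneg (by positivity),
      Real.norm_of_nonneg (by positivity), ← mul_pow]
    have h1 := pi_mul_norm_le_norm_add hτ₀ n.1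
    have := hn0 n
    gcongr
    rwa [← div_eq_mul_inv, le_div_iff₀ this]
  let v : {n : Fin d → ℤ // n ≠ 0} →ᵇ ℂ :=
    BoundedContinuousFunction.ofNormedAddCommGroupDiscrete
      (fun n => (q τ₀ n)⁻¹) (Real.pi ^ 2)⁻¹ fun n => by
        rw [norm_inv]
        exact inv_anti₀ (by positivity) (hlow n)
  have hunit : IsUnit (q τ₀) := by
    refine IsUnit.of_mul_eq_one v ?_
    ext n
    have : q τ₀ n ≠ 0 := norm_pos_iff.1 (lt_of_lt_of_le (by positivity) (hlow n))
    simp [v, this]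
  refine ⟨fun τ => P τ * Ring.inverse (q τ), hPa.mul ?_, ?_⟩
  · have h : AnalyticAt ℝ Ring.inverse (q τ₀) := analyticAt_inverse (𝕜 := ℝ) hunit.unit
    exact h.fun_comp hqa
  · filter_upwards [hqa.continuousAt.eventually (Units.isOpen.mem_nhds hunit)] with τ hτ n
    have h1 : q τ n * Ring.inverse (q τ) n = 1 := by
      rw [← BoundedContinuousFunction.mul_apply, Ring.mul_inverse_cancel _ hτ]
      rfl
    have h2 : q τ n ≠ 0 := left_ne_zero_of_mul_eq_one h1
    rw [BoundedContinuousFunction.mul_apply, eq_inv_of_mul_eq_one_right h1, hP, hq]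
    rw [hq] at h2
    have h3 := mul_ne_zero_iff.1 h2
    rw [← div_eq_mul_inv, mul_div_mul_right _ _ h3.2]

theorem ewaldPoissonTerm_kernelSymbol (p : MvPolynomial (Fin d) ℂ) (β : ℝ) (n : Fin d → ℤ)
    (τ : EuclideanSpace ℝ (Fin d)) :
    ewaldPoissonTerm (kernelSymbol p) β n τ =
      kernelSymbol p (τ + (2 * Real.pi) • latticePt n) *
        ((Real.exp (-‖τ + (2 * Real.pi) • latticePt n‖ ^ 2 / (4 * β ^ 2)) : ℝ) : ℂ) := rfl

theorem analyticAt_norm_sq (τ : EuclideanSpace ℝ (Fin d)) :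
    AnalyticAt ℝ (fun τ : EuclideanSpace ℝ (Fin d) => ‖τ‖ ^ 2) τ := by
  have h1 : AnalyticAt ℝ (fun τ : EuclideanSpace ℝ (Fin d) => ∑ j, τ j * τ j) τ :=
    Finset.analyticAt_fun_sum _ fun j _ =>
      ((EuclideanSpace.proj j : EuclideanSpace ℝ (Fin d) →L[ℝ] ℝ).analyticAt τ).mul
        ((EuclideanSpace.proj j : EuclideanSpace ℝ (Fin d) →L[ℝ] ℝ).analyticAt τ)
  refine h1.congr (.of_forall fun τ => ?_)
  beta_reduce
  rw [EuclideanSpace.norm_sq_eq]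
  simp [pow_two]

theorem analyticAt_tsum_ewaldPoissonTerm {p : MvPolynomial (Fin d) ℂ} (hp : p.IsHomogeneous 2)
    {β : ℝ} (hβ : 0 < β) {τ₀ : EuclideanSpace ℝ (Fin d)} (hτ₀ : τ₀ ∈ periodCube d) :
    AnalyticAt ℝ (fun τ => ∑' n : {n : Fin d → ℤ // n ≠ 0},
      ewaldPoissonTerm (kernelSymbol p) β n.1 τ) τ₀ := by
  obtain ⟨b, hb, hbe⟩ := exists_analyticAt_quotient hp hτ₀
  let L : {n : Fin d → ℤ // n ≠ 0} → EuclideanSpace ℝ (Fin d) →L[ℝ] ℂ := fun n =>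
    (-(Real.pi / β ^ 2)) • (Complex.ofRealCLM.comp (innerSL ℝ (latticePt n.1)))
  have hL : ∀ n, ‖L n‖ ≤ Real.pi / β ^ 2 * ‖latticePt n.1‖ := fun n => by
    refine ContinuousLinearMap.opNorm_le_bound _ (by positivity) fun y => ?_
    have h1 : ‖L n y‖ = Real.pi / β ^ 2 * |inner ℝ (latticePt n.1) y| := by
      simp [L, abs_of_pos Real.pi_pos]
    rw [h1, mul_assoc]
    gcongr
    exact abs_real_inner_le_norm _ _
  let a : {n : Fin d → ℤ // n ≠ 0} → ℂ := fun n =>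
    ((Real.exp (-(Real.pi ^ 2 / β ^ 2) * ‖latticePt n.1‖ ^ 2) : ℝ) : ℂ)
  have h := analyticAt_tsum_exp_mul L a (fun r => ?_)
    (ev := fun n => BoundedContinuousFunction.evalCLM ℂ n)
    (fun n => ContinuousLinearMap.opNorm_le_bound _ zero_le_one fun f => by
      simpa using f.norm_coe_le_norm n) hb
  · have hexp : AnalyticAt ℝ (fun τ : EuclideanSpace ℝ (Fin d) =>
        -((Real.pi ^ ((d : ℝ) / 2) / Real.Gamma ((d : ℝ) / 2 + 1) : ℝ) : ℂ) *
          ((Real.exp (-‖τ‖ ^ 2 / (4 * β ^ 2)) : ℝ) : ℂ)) τ₀ := by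
      refine analyticAt_const.mul ((Complex.ofRealCLM.analyticAt _).fun_comp ?_)
      exact ((analyticAt_norm_sq τ₀).neg.div_const).rexp'
    refine (hexp.fun_mul h).congr ?_
    filter_upwards [hbe] with τ hτ
    rw [← tsum_mul_left]
    refine tsum_congr fun n => ?_
    rw [BoundedContinuousFunction.evalCLM_apply, ewaldPoissonTerm_kernelSymbol, kernelSymbol, hτ]
    have h1 : Complex.exp (L n τ) =
        ((Real.exp (-(Real.pi / β ^ 2) * inner ℝ (latticePt n.1) τ) : ℝ) : ℂ) := by
      rw [Complex.ofReal_exp]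
      congr 1
      simp [L]
    have h2 : Real.exp (-‖τ + (2 * Real.pi) • latticePt n.1‖ ^ 2 / (4 * β ^ 2)) =
        Real.exp (-‖τ‖ ^ 2 / (4 * β ^ 2)) *
          (Real.exp (-(Real.pi / β ^ 2) * inner ℝ (latticePt n.1) τ) *
            Real.exp (-(Real.pi ^ 2 / β ^ 2) * ‖latticePt n.1‖ ^ 2)) := by
      rw [← Real.exp_add, ← Real.exp_add, norm_add_lattice_sq]
      congr 1
      field_simp
      ring
    rw [h1, h2, Complex.ofReal_mul, Complex.ofReal_mul]
    ring
  · have hs := (summable_exp_mul_norm_sub d (c := Real.pi ^ 2 / β ^ 2) (by positivity)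
      (|r| * (Real.pi / β ^ 2))).subtype {n : Fin d → ℤ | n ≠ 0}
    refine Summable.of_nonneg_of_le (fun n => by positivity) (fun n => ?_) hs
    have h1 : Real.exp (r * ‖L n‖) ≤ Real.exp (|r| * (Real.pi / β ^ 2) * ‖latticePt n.1‖) := by
      refine Real.exp_le_exp.2 ?_
      rw [mul_assoc]
      exact mul_le_mul (le_abs_self r) (hL n) (norm_nonneg _) (abs_nonneg r)
    simp only [a, Function.comp_apply]
    rw [Complex.norm_real, Real.norm_of_nonneg (Real.exp_pos _).le, sub_eq_add_neg, Real.exp_add,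
      ← neg_mul]
    gcongr

/-! ### The Ewald representation and its remainder -/

/-- Gaussian decay of the terms in the lattice index gives exponential convergence. -/
theorem exponentiallyConvergentOn_of_norm_le {ι : Type} {pt : ι → (Fin d → ℤ)}
    (hpt : Function.Injective pt) {a : ι → EuclideanSpace ℝ (Fin d) → ℂ}
    {S : Set (EuclideanSpace ℝ (Fin d))} {C c : ℝ} (hc : 0 < c)
    (h : ∀ i, ∀ τ ∈ S, ‖a i τ‖ ≤ C * Real.exp (-c * ‖latticePt (pt i)‖ ^ 2)) :
    ExponentiallyConvergentOn pt a S := by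
  have hs : ∀ c : ℝ, 0 < c → Summable fun i => Real.exp (-c * ‖latticePt (pt i)‖ ^ 2) :=
    fun c hc => (summable_exp_neg_mul_norm_sq d hc).comp_injective hpt
  refine ⟨|C| * ∑' i, Real.exp (-(c / 2) * ‖latticePt (pt i)‖ ^ 2), c / 2, half_pos hc,
    fun τ hτ => ?_⟩
  have hsum : Summable fun i => ‖a i τ‖ := Summable.of_nonneg_of_le (fun i => norm_nonneg _)
    (fun i => h i τ hτ) ((hs c hc).mul_left C)
  refine ⟨hsum, fun R hR => ?_⟩
  have hs2 := ((hs (c / 2) (half_pos hc)).mul_left |C|).mul_right (Real.exp (-(c / 2) * R ^ 2))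
  rw [← tsum_mul_left, ← tsum_mul_right]
  refine Summable.tsum_le_tsum_of_inj (fun i => i.1) Subtype.val_injective
    (fun i _ => by positivity) (fun i => ?_) (hsum.subtype _) hs2
  refine (h i.1 τ hτ).trans ?_
  rw [mul_assoc, ← Real.exp_add]
  refine mul_le_mul (le_abs_self C) (Real.exp_le_exp.2 ?_) (Real.exp_pos _).le (abs_nonneg C)
  have h1 : R ^ 2 ≤ ‖latticePt (pt i.1)‖ ^ 2 := pow_le_pow_left₀ hR i.2.le 2
  nlinarith

/-- On the period cube `|τ + 2πn| ≥ π |n|`, which makes the Gaussian decay uniform in `τ`. -/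
theorem exists_norm_ewaldPoissonTerm_le {p : MvPolynomial (Fin d) ℂ} (hp : p.IsHomogeneous 2)
    {β : ℝ} (hβ : 0 < β) : ∃ C : ℝ, 0 ≤ C ∧ ∀ (n : Fin d → ℤ), ∀ τ ∈ periodCube d,
      ‖ewaldPoissonTerm (kernelSymbol p) β n τ‖ ≤
        C * Real.exp (-(Real.pi ^ 2 / (4 * β ^ 2)) * ‖latticePt n‖ ^ 2) := by
  obtain ⟨C, hC0, hC⟩ := exists_norm_kernelSymbol_le hp
  refine ⟨C, hC0, fun n τ hτ => ?_⟩
  rw [ewaldPoissonTerm_kernelSymbol, norm_mul, Complex.norm_real,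
    Real.norm_of_nonneg (Real.exp_pos _).le]
  gcongr
  · exact hC _
  · have h1 := pi_mul_norm_le_norm_add hτ n
    have h2 := pow_le_pow_left₀ (by positivity) h1 2
    rw [neg_div, neg_mul, neg_le_neg_iff, div_mul_eq_mul_div, ← mul_pow]
    gcongr

theorem summable_ewaldFourierTerm {p : MvPolynomial (Fin d) ℂ} (hp : p.IsHomogeneous 2) {β : ℝ}
    (hβ : 0 < β) (τ : EuclideanSpace ℝ (Fin d)) :
    Summable fun m : Fin d → ℤ => ewaldFourierTerm p β m τ := by
  obtain ⟨C, hC0, hC⟩ := exists_norm_ewaldFourierTerm_le hp β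
  exact Summable.of_norm_bounded
    ((summable_exp_neg_mul_norm_sq d (c := β ^ 2 / 2) (by positivity)).mul_left C) fun m => hC m τ

theorem latticePt_add (m n : Fin d → ℤ) : latticePt (m + n) = latticePt m + latticePt n := by
  ext j
  simp [latticePt_apply]

theorem exists_add_mem_periodCube (τ : EuclideanSpace ℝ (Fin d)) :
    ∃ n : Fin d → ℤ, τ + (2 * Real.pi) • latticePt n ∈ periodCube d := by
  refine ⟨fun j => -round (τ j / (2 * Real.pi)), fun j => ?_⟩
  have h := abs_le.1 (abs_sub_round (τ j / (2 * Real.pi)))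
  have hpi := Real.pi_pos
  have e : (τ + (2 * Real.pi) • latticePt fun j => -round (τ j / (2 * Real.pi))) j =
      2 * Real.pi * (τ j / (2 * Real.pi) - round (τ j / (2 * Real.pi))) := by
    simp [latticePt_apply]
    field_simp
    ring
  rw [e]
  constructor <;> nlinarith

/-- Translating by a period shifts the summation index of the Poisson sum. -/
theorem ewaldPoissonTerm_add (p : MvPolynomial (Fin d) ℂ) (β : ℝ) (n k : Fin d → ℤ)
    (τ : EuclideanSpace ℝ (Fin d)) :
    ewaldPoissonTerm (kernelSymbol p) β k (τ + (2 * Real.pi) • latticePt n) =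
      ewaldPoissonTerm (kernelSymbol p) β (n + k) τ := by
  rw [ewaldPoissonTerm_kernelSymbol, ewaldPoissonTerm_kernelSymbol, latticePt_add, smul_add,
    add_assoc]

theorem summable_ewaldPoissonTerm {p : MvPolynomial (Fin d) ℂ} (hp : p.IsHomogeneous 2) {β : ℝ}
    (hβ : 0 < β) (τ : EuclideanSpace ℝ (Fin d)) :
    Summable fun n : Fin d → ℤ => ewaldPoissonTerm (kernelSymbol p) β n τ := by
  obtain ⟨C, hC0, hC⟩ := exists_norm_ewaldPoissonTerm_le hp hβ
  obtain ⟨n, hn⟩ := exists_add_mem_periodCube τ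
  have h := Summable.of_norm_bounded ((summable_exp_neg_mul_norm_sq d
    (c := Real.pi ^ 2 / (4 * β ^ 2)) (by positivity)).mul_left C) fun k => hC k _ hn
  simp_rw [ewaldPoissonTerm_add] at h
  exact (Equiv.addLeft n).summable_iff.1 h

/-- The Ewald representation of the Toeplitz symbol with splitting parameter `β`; the index `m = 0`
contributes nothing to the first sum because `K(0)` has the value `0`. -/
def ewaldSymbol (p : MvPolynomial (Fin d) ℂ) (β : ℝ) (τ : EuclideanSpace ℝ (Fin d)) : ℂ :=
  (∑' m : Fin d → ℤ, ewaldFourierTerm p β m τ) +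
    ∑' n : Fin d → ℤ, ewaldPoissonTerm (kernelSymbol p) β n τ

/-- The difference of the Ewald representation and the symbol of `K`. -/
def ewaldRemainder (p : MvPolynomial (Fin d) ℂ) (β : ℝ) (τ : EuclideanSpace ℝ (Fin d)) : ℂ :=
  (∑' m : Fin d → ℤ, ewaldFourierTerm p β m τ) +
    (∑' n : {n : Fin d → ℤ // n ≠ 0}, ewaldPoissonTerm (kernelSymbol p) β n.1 τ) +
    kernelSymbol p τ * ((Real.exp (-‖τ‖ ^ 2 / (4 * β ^ 2)) - 1 : ℝ) : ℂ)

theorem ewaldPoissonTerm_zero (p : MvPolynomial (Fin d) ℂ) (β : ℝ)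
    (τ : EuclideanSpace ℝ (Fin d)) :
    ewaldPoissonTerm (kernelSymbol p) β 0 τ =
      kernelSymbol p τ * ((Real.exp (-‖τ‖ ^ 2 / (4 * β ^ 2)) : ℝ) : ℂ) := by
  rw [ewaldPoissonTerm_kernelSymbol, latticePt_zero, smul_zero, add_zero]

theorem tsum_eq_zero_add_subtype {α : Type*} {f : α → ℂ} (hf : Summable f) (a : α) :
    ∑' x, f x = f a + ∑' x : {x : α // x ≠ a}, f x.1 := by
  rw [← hf.tsum_subtype_add_tsum_subtype_compl {a}]
  congr 1
  exact tsum_singleton a f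

theorem ewaldSymbol_eq {p : MvPolynomial (Fin d) ℂ} (hp : p.IsHomogeneous 2) {β : ℝ}
    (hβ : 0 < β) (τ : EuclideanSpace ℝ (Fin d)) :
    ewaldSymbol p β τ = kernelSymbol p τ + ewaldRemainder p β τ := by
  rw [ewaldSymbol, ewaldRemainder, tsum_eq_zero_add_subtype (summable_ewaldPoissonTerm hp hβ τ) 0,
    ewaldPoissonTerm_zero]
  push_cast
  ring

theorem analyticAt_polyAt {p : MvPolynomial (Fin d) ℂ} (hp : p.IsHomogeneous 2)
    (τ : EuclideanSpace ℝ (Fin d)) : AnalyticAt ℝ (polyAt p) τ := by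
  obtain ⟨A, hA⟩ := exists_quadraticForm hp
  have hj : ∀ j : Fin d, AnalyticAt ℝ (fun x : EuclideanSpace ℝ (Fin d) => (x j : ℂ)) τ :=
    fun j => (Complex.ofRealCLM.comp
      (EuclideanSpace.proj j : EuclideanSpace ℝ (Fin d) →L[ℝ] ℝ)).analyticAt τ
  rw [show polyAt p = _ from funext hA]
  exact Finset.analyticAt_fun_sum _ fun j _ => Finset.analyticAt_fun_sum _ fun k _ =>
    analyticAt_const.mul ((hj j).mul (hj k))

theorem analyticAt_kernelSymbol {p : MvPolynomial (Fin d) ℂ} (hp : p.IsHomogeneous 2)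
    {τ : EuclideanSpace ℝ (Fin d)} (hτ : τ ≠ 0) : AnalyticAt ℝ (kernelSymbol p) τ := by
  have h1 : AnalyticAt ℝ (fun τ : EuclideanSpace ℝ (Fin d) => ((‖τ‖ ^ 2 : ℝ) : ℂ)) τ :=
    (Complex.ofRealCLM.analyticAt _).fun_comp (analyticAt_norm_sq τ)
  refine (analyticAt_const.mul ((analyticAt_polyAt hp τ).div h1 ?_)).neg
  have : 0 < ‖τ‖ := norm_pos_iff.2 hτ
  exact Complex.ofReal_ne_zero.2 (by positivity)

theorem analyticAt_dslope {f : ℝ → ℝ} (hf : ∀ s, AnalyticAt ℝ f s) (a s : ℝ) :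
    AnalyticAt ℝ (dslope f a) s := by
  rcases eq_or_ne s a with rfl | hs
  · obtain ⟨q, hq⟩ := hf s
    exact hq.has_fpower_series_dslope_fslope.analyticAt
  · have h1 : AnalyticAt ℝ (fun s => (s - a)⁻¹ * (f s - f a)) s :=
      ((analyticAt_id.sub analyticAt_const).inv (sub_ne_zero.2 hs)).mul
        ((hf s).sub analyticAt_const)
    refine h1.congr ?_
    filter_upwards [isOpen_ne.mem_nhds hs] with t ht
    rw [dslope_of_ne _ ht, slope_def_field, div_eq_inv_mul]

/-- The singularity of the symbol at the origin cancels in `Khat(τ) (e^{-|τ|²/(4β²)} - 1)`. -/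
theorem analyticAt_kernelSymbol_mul_exp_sub_one {p : MvPolynomial (Fin d) ℂ}
    (hp : p.IsHomogeneous 2) (β : ℝ) (τ : EuclideanSpace ℝ (Fin d)) :
    AnalyticAt ℝ (fun τ => kernelSymbol p τ *
      ((Real.exp (-‖τ‖ ^ 2 / (4 * β ^ 2)) - 1 : ℝ) : ℂ)) τ := by
  have hf : ∀ s, AnalyticAt ℝ (fun s : ℝ => Real.exp (-s / (4 * β ^ 2))) s := fun s =>
    (analyticAt_id.neg.div_const).rexp'
  have h1 : AnalyticAt ℝ (fun τ : EuclideanSpace ℝ (Fin d) =>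
      ((dslope (fun s : ℝ => Real.exp (-s / (4 * β ^ 2))) 0 (‖τ‖ ^ 2) : ℝ) : ℂ)) τ :=
    (Complex.ofRealCLM.analyticAt _).fun_comp
      ((analyticAt_dslope hf 0 _).fun_comp (analyticAt_norm_sq τ))
  refine ((analyticAt_const (v :=
    -((Real.pi ^ ((d : ℝ) / 2) / Real.Gamma ((d : ℝ) / 2 + 1) : ℝ) : ℂ))).fun_mul
      ((analyticAt_polyAt hp τ).fun_mul h1)).congr (.of_forall fun y => ?_)
  rcases eq_or_ne y 0 with rfl | hy
  · simp [polyAt_zero hp, kernelSymbol]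
  · have hy' : ‖y‖ ^ 2 ≠ 0 := by
      have := norm_pos_iff.2 hy
      positivity
    beta_reduce
    rw [dslope_of_ne _ hy', slope_def_field, kernelSymbol]
    simp only [neg_zero, zero_div, Real.exp_zero, sub_zero]
    push_cast
    ring

theorem analyticAt_ewaldRemainder {p : MvPolynomial (Fin d) ℂ} (hp : p.IsHomogeneous 2)
    {β : ℝ} (hβ : 0 < β) {τ : EuclideanSpace ℝ (Fin d)} (hτ : τ ∈ periodCube d) :
    AnalyticAt ℝ (ewaldRemainder p β) τ :=
  ((analyticAt_tsum_ewaldFourierTerm hp hβ τ).add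
    (analyticAt_tsum_ewaldPoissonTerm hp hβ hτ)).add
      (analyticAt_kernelSymbol_mul_exp_sub_one hp β τ)

/-- At the origin both lattice sums vanish, as sums of `p` times a radial weight. -/
theorem ewaldRemainder_zero (hd : 0 < d) {p : MvPolynomial (Fin d) ℂ} (hp : p.IsHomogeneous 2)
    (hc : CancellationCondition p) {β : ℝ} (hβ : 0 < β) : ewaldRemainder p β 0 = 0 := by
  have hG : 0 < Real.Gamma ((d : ℝ) / 2 + 1) := Real.Gamma_pos_of_pos (by positivity)
  have h1 : ∑' m : Fin d → ℤ, ewaldFourierTerm p β m 0 = 0 := by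
    -- The inverse power is `0` at `r = 0`, in accordance with `kernelK p 0 = 0`.
    let w : ℝ → ℂ := fun r => (((r ^ (d + 2))⁻¹ *
      (upperGamma ((d : ℝ) / 2 + 1) (β ^ 2 * r ^ 2) / Real.Gamma ((d : ℝ) / 2 + 1)) : ℝ) : ℂ)
    rw [← tsum_polyAt_mul_radial hd hp hc w]
    · refine tsum_congr fun m => ?_
      simp only [ewaldFourierTerm, kernelK, latticeExp, inner_zero_right, Complex.ofReal_zero,
        mul_zero, Complex.exp_zero, mul_one, w]
      push_cast
      ring
    · obtain ⟨D, hD0, hD⟩ := exists_upperGamma_le d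
      refine Summable.of_nonneg_of_le (fun m => by positivity) (fun m => ?_)
        ((summable_exp_neg_mul_norm_sq d (c := β ^ 2 / 2) (by positivity)).mul_left
          (D / Real.Gamma ((d : ℝ) / 2 + 1)))
      rcases eq_or_ne m 0 with rfl | hm
      · rw [latticePt_zero, norm_zero]
        simp only [ne_eq, OfNat.ofNat_ne_zero, not_false_eq_true, zero_pow, zero_mul]
        positivity
      have hm1 := one_le_norm_latticePt hm
      have hu : 0 ≤ upperGamma ((d : ℝ) / 2 + 1) (β ^ 2 * ‖latticePt m‖ ^ 2) :=
        upperGamma_nonneg (by positivity)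
      have hpow : ‖latticePt m‖ ^ 2 * (‖latticePt m‖ ^ (d + 2))⁻¹ ≤ 1 := by
        rw [← div_eq_mul_inv, div_le_one (by positivity)]
        exact pow_le_pow_right₀ hm1 (by omega)
      have hw : ‖w ‖latticePt m‖‖ = (‖latticePt m‖ ^ (d + 2))⁻¹ *
          (upperGamma ((d : ℝ) / 2 + 1) (β ^ 2 * ‖latticePt m‖ ^ 2) /
            Real.Gamma ((d : ℝ) / 2 + 1)) := by
        rw [Complex.norm_real, Real.norm_of_nonneg (by positivity)]
      rw [hw, ← mul_assoc]
      refine (mul_le_of_le_one_left (by positivity) hpow).trans ?_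
      rw [div_mul_eq_mul_div]
      gcongr
      refine (hD _ (by positivity)).trans (le_of_eq ?_)
      congr 2
      ring
  have h2 : ∑' n : {n : Fin d → ℤ // n ≠ 0}, ewaldPoissonTerm (kernelSymbol p) β n.1 0 = 0 := by
    have hsplit := tsum_eq_zero_add_subtype
      (summable_ewaldPoissonTerm hp hβ 0) 0
    rw [ewaldPoissonTerm_zero, show kernelSymbol p 0 = 0 by
      rw [kernelSymbol, polyAt_zero hp, zero_div, mul_zero, neg_zero], zero_mul, zero_add] at hsplit
    rw [← hsplit]
    let w : ℝ → ℂ := fun r =>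
      ((-(Real.pi ^ ((d : ℝ) / 2) / Real.Gamma ((d : ℝ) / 2 + 1)) * (r ^ 2)⁻¹ *
        Real.exp (-(Real.pi ^ 2 / β ^ 2) * r ^ 2) : ℝ) : ℂ)
    rw [← tsum_polyAt_mul_radial hd hp hc w]
    · refine tsum_congr fun n => ?_
      have hpi : (Real.pi : ℂ) ≠ 0 := Complex.ofReal_ne_zero.2 Real.pi_ne_zero
      have e1 : Real.exp (-‖(2 * Real.pi) • latticePt n‖ ^ 2 / (4 * β ^ 2)) =
          Real.exp (-(Real.pi ^ 2 / β ^ 2) * ‖latticePt n‖ ^ 2) := by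
        rw [norm_smul, Real.norm_of_nonneg (by positivity : 0 ≤ 2 * Real.pi)]
        congr 1
        field_simp
        ring
      have e2 : (((2 * Real.pi * ‖latticePt n‖) ^ 2 : ℝ) : ℂ) =
          ((2 * Real.pi : ℝ) : ℂ) ^ 2 * ((‖latticePt n‖ ^ 2 : ℝ) : ℂ) := by
        push_cast
        ring
      rw [ewaldPoissonTerm_kernelSymbol, zero_add, e1, kernelSymbol, polyAt_smul hp, norm_smul,
        Real.norm_of_nonneg (by positivity : 0 ≤ 2 * Real.pi), e2,
        mul_div_mul_left _ _ (by simp [hpi])]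
      simp only [w, Complex.ofReal_mul, Complex.ofReal_neg, Complex.ofReal_inv]
      ring
    · refine Summable.of_nonneg_of_le (fun m => by positivity) (fun m => ?_)
        ((summable_exp_neg_mul_norm_sq d (c := Real.pi ^ 2 / β ^ 2) (by positivity)).mul_left
          (Real.pi ^ ((d : ℝ) / 2) / Real.Gamma ((d : ℝ) / 2 + 1)))
      rw [Complex.norm_real, norm_mul, norm_mul, norm_neg, norm_inv,
        Real.norm_of_nonneg (Real.exp_pos _).le, Real.norm_of_nonneg (by positivity),
        Real.norm_of_nonneg (by positivity : 0 ≤ ‖latticePt m‖ ^ 2)]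
      rcases eq_or_ne m 0 with rfl | hm
      · rw [latticePt_zero, norm_zero]
        simp only [ne_eq, OfNat.ofNat_ne_zero, not_false_eq_true, zero_pow, zero_mul]
        positivity
      have hm1 : 0 < ‖latticePt m‖ := one_pos.trans_le (one_le_norm_latticePt hm)
      refine le_of_eq ?_
      field_simp
  rw [ewaldRemainder, h1, h2, norm_zero]
  simp

theorem latticeExp_add (m n : Fin d → ℤ) (τ : EuclideanSpace ℝ (Fin d)) :
    latticeExp m (τ + (2 * Real.pi) • latticePt n) = latticeExp m τ := by
  have h : inner ℝ (latticePt m) (latticePt n) = ((∑ j, n j * m j : ℤ) : ℝ) := by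
    simp [PiLp.inner_apply, latticePt_apply]
  have h2 : Complex.I * ((inner ℝ (latticePt m) τ +
      2 * Real.pi * ((∑ j, n j * m j : ℤ) : ℝ) : ℝ) : ℂ) =
      Complex.I * ((inner ℝ (latticePt m) τ : ℝ) : ℂ) +
        ((∑ j, n j * m j : ℤ) : ℂ) * (2 * Real.pi * Complex.I) := by
    push_cast
    ring
  rw [latticeExp, latticeExp, inner_add_right, inner_smul_right, h, h2,
    Complex.exp_periodic.int_mul]

theorem ewaldSymbol_periodic (p : MvPolynomial (Fin d) ℂ) (β : ℝ) (τ : EuclideanSpace ℝ (Fin d))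
    (n : Fin d → ℤ) : ewaldSymbol p β (τ + (2 * Real.pi) • latticePt n) = ewaldSymbol p β τ := by
  rw [ewaldSymbol, ewaldSymbol]
  congr 1
  · exact tsum_congr fun m => by rw [ewaldFourierTerm, latticeExp_add, ewaldFourierTerm]
  · rw [← (Equiv.addLeft n).tsum_eq fun k => ewaldPoissonTerm (kernelSymbol p) β k τ]
    exact tsum_congr fun k => ewaldPoissonTerm_add p β n k τ

theorem exists_norm_ewaldSymbol_le {p : MvPolynomial (Fin d) ℂ} (hp : p.IsHomogeneous 2)
    {β : ℝ} (hβ : 0 < β) : ∃ C : ℝ, ∀ τ, ‖ewaldSymbol p β τ‖ ≤ C := by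
  obtain ⟨C, hC0, hC⟩ := exists_norm_ewaldFourierTerm_le hp β
  obtain ⟨D, hD0, hD⟩ := exists_norm_ewaldPoissonTerm_le hp hβ
  refine ⟨(∑' m : Fin d → ℤ, C * Real.exp (-(β ^ 2 / 2) * ‖latticePt m‖ ^ 2)) +
    ∑' n : Fin d → ℤ, D * Real.exp (-(Real.pi ^ 2 / (4 * β ^ 2)) * ‖latticePt n‖ ^ 2),
    fun τ => ?_⟩
  obtain ⟨n, hn⟩ := exists_add_mem_periodCube τ
  rw [← ewaldSymbol_periodic p β τ n, ewaldSymbol]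
  refine (norm_add_le _ _).trans (add_le_add
    (tsum_of_norm_bounded ((summable_exp_neg_mul_norm_sq d (c := β ^ 2 / 2)
      (by positivity)).mul_left C).hasSum fun m => hC m _)
    (tsum_of_norm_bounded ((summable_exp_neg_mul_norm_sq d (c := Real.pi ^ 2 / (4 * β ^ 2))
      (by positivity)).mul_left D).hasSum fun m => hD m _ hn))

theorem add_lattice_ne_zero {τ : EuclideanSpace ℝ (Fin d)} (hτ : τ ∈ periodCube d \ {0})
    (n : Fin d → ℤ) : τ + (2 * Real.pi) • latticePt n ≠ 0 := by
  rcases eq_or_ne n 0 with rfl | hn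
  · simpa [latticePt_zero] using hτ.2
  · have h1 := pi_mul_norm_le_norm_add hτ.1 n
    have h2 := one_le_norm_latticePt hn
    exact norm_pos_iff.1 (lt_of_lt_of_le (by have := Real.pi_pos; positivity) h1)

/-! ### Fourier series on the period cube -/

/-- The half-open period cube `(-π, π]^d`, a fundamental domain of `2πℤ^d`. -/
def halfOpenCube (d : ℕ) : Set (EuclideanSpace ℝ (Fin d)) :=
  {τ | ∀ j, τ j ∈ Set.Ioc (-Real.pi) Real.pi}

theorem measurable_coord (j : Fin d) : Measurable fun x : EuclideanSpace ℝ (Fin d) => x j :=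
  (EuclideanSpace.proj j : EuclideanSpace ℝ (Fin d) →L[ℝ] ℝ).continuous.measurable

theorem measurableSet_halfOpenCube (d : ℕ) : MeasurableSet (halfOpenCube d) := by
  have : halfOpenCube d = ⋂ j, (fun x : EuclideanSpace ℝ (Fin d) => x j) ⁻¹'
      Set.Ioc (-Real.pi) Real.pi := by
    ext x
    simp [halfOpenCube]
  rw [this]
  exact MeasurableSet.iInter fun j => measurable_coord j measurableSet_Ioc

theorem isCompact_periodCube (d : ℕ) : IsCompact (periodCube d) := by
  have h : periodCube d = (EuclideanSpace.equiv (Fin d) ℝ) ⁻¹'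
      Set.pi Set.univ fun _ => Set.Icc (-Real.pi) Real.pi := by
    ext x
    simp [periodCube, Pi.le_def, forall_and]
  rw [h]
  exact (EuclideanSpace.equiv (Fin d) ℝ).toHomeomorph.isCompact_preimage.2
    (isCompact_univ_pi fun _ => isCompact_Icc)

theorem restrict_halfOpenCube (d : ℕ) :
    (volume : Measure (EuclideanSpace ℝ (Fin d))).restrict (halfOpenCube d) =
      volume.restrict (periodCube d) := by
  refine Measure.restrict_congr_set ?_
  have h := (PiLp.volume_preserving_ofLp (Fin d)).quasiMeasurePreserving.preimage_ae_eq
    (Measure.univ_pi_Ioc_ae_eq_Icc (μ := fun _ : Fin d => (volume : Measure ℝ))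
      (f := fun _ => -Real.pi) (g := fun _ => Real.pi))
  have e1 : (WithLp.ofLp ⁻¹' Set.pi Set.univ fun _ : Fin d => Set.Ioc (-Real.pi) Real.pi) =
      halfOpenCube d := by
    ext x
    simp [halfOpenCube]
  have e2 : (WithLp.ofLp ⁻¹' Set.Icc (fun _ : Fin d => -Real.pi) fun _ => Real.pi) =
      periodCube d := by
    ext x
    simp [periodCube, Pi.le_def, forall_and]
  rw [e1, e2] at h
  exact h

/-- Unfolding: integrating a periodization over the period cube is integrating over the space. -/
theorem integral_periodCube_tsum {h : EuclideanSpace ℝ (Fin d) → ℂ} (hh : Integrable h) :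
    ∫ τ in periodCube d, ∑' n : Fin d → ℤ, h (τ + (2 * Real.pi) • latticePt n) = ∫ ξ, h ξ := by
  rw [← restrict_halfOpenCube]
  let s : (Fin d → ℤ) → Set (EuclideanSpace ℝ (Fin d)) := fun n =>
    (fun ξ => ξ + -((2 * Real.pi) • latticePt n)) ⁻¹' halfOpenCube d
  have hsm : ∀ n, MeasurableSet (s n) := fun n =>
    (measurable_add_const _) (measurableSet_halfOpenCube d)
  have hmem : ∀ n ξ, ξ ∈ s n ↔
      ∀ j, ξ j - n j • (2 * Real.pi) ∈ Set.Ioc (-Real.pi) (-Real.pi + 2 * Real.pi) := fun n ξ => by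
    have e : -Real.pi + 2 * Real.pi = Real.pi := by ring
    rw [e]
    refine forall_congr' fun j => ?_
    simp [latticePt_apply, sub_eq_add_neg, mul_comm]
  have hpi : 0 < 2 * Real.pi := by positivity
  have hdisj : Pairwise (Function.onFun Disjoint s) := fun m n hmn => by
    refine Set.disjoint_left.2 fun ξ h1 h2 => hmn (funext fun j => ?_)
    exact (existsUnique_sub_zsmul_mem_Ioc hpi (ξ j) (-Real.pi)).unique
      ((hmem m ξ).1 h1 j) ((hmem n ξ).1 h2 j)
  have hcov : ⋃ n, s n = Set.univ := by
    refine Set.eq_univ_of_forall fun ξ => Set.mem_iUnion.2 ?_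
    choose n hn using fun j => (existsUnique_sub_zsmul_mem_Ioc hpi (ξ j) (-Real.pi)).exists
    exact ⟨n, (hmem n ξ).2 hn⟩
  have htrans : ∀ (n : Fin d → ℤ), MeasurePreserving
      (fun τ : EuclideanSpace ℝ (Fin d) => τ + (2 * Real.pi) • latticePt n)
      (volume.restrict (halfOpenCube d)) (volume.restrict (s n)) := fun n => by
    have h1 := (measurePreserving_add_right (volume : Measure (EuclideanSpace ℝ (Fin d)))
      ((2 * Real.pi) • latticePt n)).restrict_preimage (hsm n)
    have h2 : (fun τ : EuclideanSpace ℝ (Fin d) => τ + (2 * Real.pi) • latticePt n) ⁻¹' s n =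
        halfOpenCube d := by
      ext τ
      simp [s]
    rwa [h2] at h1
  have hemb : ∀ n : Fin d → ℤ, MeasurableEmbedding
      (fun τ : EuclideanSpace ℝ (Fin d) => τ + (2 * Real.pi) • latticePt n) := fun n =>
    (MeasurableEquiv.addRight ((2 * Real.pi) • latticePt n)).measurableEmbedding
  have hint : ∀ n : Fin d → ℤ, Integrable (fun τ => h (τ + (2 * Real.pi) • latticePt n))
      (volume.restrict (halfOpenCube d)) := fun n =>
    ((htrans n).integrable_comp_emb (hemb n)).2 hh.integrableOn
  have h1 := hasSum_integral_iUnion hsm hdisj (f := h) hh.integrableOn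
  have h2 := hasSum_integral_iUnion hsm hdisj (f := fun ξ => ‖h ξ‖) hh.norm.integrableOn
  rw [hcov, setIntegral_univ] at h1
  have h3 := hasSum_integral_of_summable_integral_norm hint (by
    refine h2.summable.congr fun n => ?_
    exact ((htrans n).integral_comp (hemb n) fun ξ => ‖h ξ‖).symm)
  refine h3.unique (h1.congr_fun fun n => ?_)
  exact (htrans n).integral_comp (hemb n) h

section Torus

/-- The normalization of the measure on the circle used in the `L²` theory of Fourier series. -/
local instance : MeasureSpace UnitAddCircle := ⟨AddCircle.haarAddCircle⟩

/-- The normalized measure on the circle is a Haar measure. -/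
local instance : Measure.IsAddHaarMeasure (volume : Measure UnitAddCircle) :=
  inferInstanceAs (Measure.IsAddHaarMeasure AddCircle.haarAddCircle)

/-- The normalized measure on the circle is a probability measure. -/
local instance : IsProbabilityMeasure (volume : Measure UnitAddCircle) :=
  inferInstanceAs (IsProbabilityMeasure AddCircle.haarAddCircle)

/-- The representative in `(-π, π]^d` of a point of the torus. -/
def torusRepr (θ : UnitAddTorus (Fin d)) : EuclideanSpace ℝ (Fin d) :=
  (2 * Real.pi) • WithLp.toLp 2 fun j => (AddCircle.equivIoc 1 (-1 / 2 : ℝ) (θ j) : ℝ)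

/-- The representative map carries the normalized Haar measure of the torus to the normalized
Lebesgue measure of the period cube. -/
theorem measurePreserving_torusRepr (d : ℕ) :
    MeasurePreserving (torusRepr (d := d)) volume
      (ENNReal.ofReal ((2 * Real.pi) ^ d)⁻¹ • volume.restrict (periodCube d)) := by
  have hpi : 0 < 2 * Real.pi := by positivity
  have h1 := UnitAddTorus.measurePreserving_equivPiIoc (d := Fin d) fun _ => (-1 / 2 : ℝ)
  have hms : MeasurableSet {x : Fin d → ℝ | ∀ i, x i ∈ Set.Ioc (-1 / 2 : ℝ) (-1 / 2 + 1)} :=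
    MeasurableSet.univ_pi' fun _ => measurableSet_Ioc
  have h2 := measurePreserving_subtype_coe (μa := (volume : Measure (Fin d → ℝ))) hms
  have hS : MeasurableSet {x : EuclideanSpace ℝ (Fin d) |
      ∀ i, x i ∈ Set.Ioc (-1 / 2 : ℝ) (-1 / 2 + 1)} := by
    rw [Set.ofPred_forall]
    exact MeasurableSet.iInter fun j => measurable_coord j measurableSet_Ioc
  have h3 := (PiLp.volume_preserving_toLp (Fin d)).restrict_preimage hS
  have h4 : MeasurePreserving (fun x : EuclideanSpace ℝ (Fin d) => (2 * Real.pi) • x) volume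
      (ENNReal.ofReal ((2 * Real.pi) ^ d)⁻¹ • volume) := by
    refine ⟨measurable_const_smul _, ?_⟩
    rw [Measure.map_addHaar_smul _ hpi.ne', finrank_euclideanSpace_fin, abs_of_pos (by positivity)]
  have h5 := h4.restrict_preimage (measurableSet_halfOpenCube d)
  have e : (fun x : EuclideanSpace ℝ (Fin d) => (2 * Real.pi) • x) ⁻¹' halfOpenCube d =
      {x : EuclideanSpace ℝ (Fin d) | ∀ i, x i ∈ Set.Ioc (-1 / 2 : ℝ) (-1 / 2 + 1)} := by
    ext x
    refine forall_congr' fun j => ?_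
    have := Real.pi_pos
    simp only [PiLp.smul_apply, smul_eq_mul, Set.mem_Ioc]
    constructor <;> rintro ⟨h1, h2⟩ <;> constructor <;> nlinarith
  rw [e, Measure.restrict_smul, restrict_halfOpenCube] at h5
  exact h5.comp (h3.comp (h2.comp h1))

theorem mFourier_eq_latticeExp (n : Fin d → ℤ) (θ : UnitAddTorus (Fin d)) :
    UnitAddTorus.mFourier n θ = latticeExp n (torusRepr θ) := by
  have hco : ∀ j, θ j = ((AddCircle.equivIoc 1 (-1 / 2 : ℝ) (θ j) : ℝ) : UnitAddCircle) := fun j =>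
    ((AddCircle.equivIoc 1 (-1 / 2 : ℝ)).symm_apply_apply (θ j)).symm
  change ∏ j, fourier (n j) (θ j) = _
  have h1 : ∀ j, (fourier (n j) (θ j) : ℂ) = Complex.exp (2 * Real.pi * Complex.I * n j *
      ((AddCircle.equivIoc 1 (-1 / 2 : ℝ) (θ j) : ℝ) : ℂ)) := fun j => by
    conv_lhs => rw [hco j]
    rw [fourier_coe_apply]
    simp
  simp_rw [h1]
  rw [← Complex.exp_sum, latticeExp, torusRepr, inner_smul_right, PiLp.inner_apply]
  congr 1
  push_cast
  rw [Finset.mul_sum, Finset.mul_sum]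
  refine Finset.sum_congr rfl fun j _ => ?_
  simp [latticePt_apply]
  ring

/-- The multiple Fourier series of a square integrable function on the period cube converges
unconditionally in `L²`. -/
theorem tendsto_eLpNorm_sub_fourierSeries {G : EuclideanSpace ℝ (Fin d) → ℂ}
    (hG : MemLp G 2 (volume.restrict (periodCube d))) {c : (Fin d → ℤ) → ℂ}
    (hc : ∀ m, (((2 * Real.pi) ^ d : ℝ) : ℂ) * c m =
      ∫ τ in periodCube d, G τ * latticeExp (-m) τ) :
    Tendsto (fun S : Finset (Fin d → ℤ) => eLpNorm (fun τ => G τ - ∑ m ∈ S, c m * latticeExp m τ) 2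
      (volume.restrict (periodCube d))) atTop (𝓝 0) := by
  have hpi : 0 < (2 * Real.pi) ^ d := by positivity
  have hR := measurePreserving_torusRepr d
  have hk0 : ENNReal.ofReal ((2 * Real.pi) ^ d)⁻¹ ≠ 0 := by simp [Real.pi_pos]
  have hG' := hG.smul_measure (c := ENNReal.ofReal ((2 * Real.pi) ^ d)⁻¹) ENNReal.ofReal_ne_top
  have hg : MemLp (G ∘ torusRepr) 2 (volume : Measure (UnitAddTorus (Fin d))) :=
    hG'.comp_measurePreserving hR
  have hlatc : ∀ m : Fin d → ℤ, Continuous (latticeExp m) := fun m => by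
    unfold latticeExp
    fun_prop
  have hcoeff : ∀ m, UnitAddTorus.mFourierCoeff (hg.toLp : UnitAddTorus (Fin d) → ℂ) m = c m := by
    intro m
    have h1 : UnitAddTorus.mFourierCoeff (hg.toLp : UnitAddTorus (Fin d) → ℂ) m =
        ∫ θ, (fun τ => G τ * latticeExp (-m) τ) (torusRepr θ) := by
      refine integral_congr_ae ?_
      filter_upwards [hg.coeFn_toLp] with θ hθ
      rw [hθ, mFourier_eq_latticeExp, smul_eq_mul, mul_comm]
      rfl
    have h2 := integral_map hR.measurable.aemeasurable
      (f := fun τ => G τ * latticeExp (-m) τ) (by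
        rw [hR.map_eq]
        exact hG'.1.mul (hlatc _).aestronglyMeasurable)
    rw [h1]
    refine h2.symm.trans ?_
    rw [hR.map_eq, integral_smul_measure, ← hc,
      ENNReal.toReal_ofReal (by positivity), Complex.real_smul, ← mul_assoc, ← Complex.ofReal_mul,
      inv_mul_cancel₀ hpi.ne', Complex.ofReal_one, one_mul]
  have hsum := UnitAddTorus.hasSum_mFourier_series_L2 hg.toLp
  simp_rw [hcoeff] at hsum
  have hsum' := (Lp.tendsto_Lp_iff_tendsto_eLpNorm' _ _).1 hsum
  -- Pulling back along `torusRepr` scales the `L²` norm by a constant factor.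
  have hconv : ∀ S : Finset (Fin d → ℤ),
      eLpNorm (fun τ => G τ - ∑ m ∈ S, c m * latticeExp m τ) 2 (volume.restrict (periodCube d)) =
      ((ENNReal.ofReal ((2 * Real.pi) ^ d)⁻¹) ^ (1 / (2 : ENNReal)).toReal)⁻¹ *
        eLpNorm (((∑ m ∈ S, c m • UnitAddTorus.mFourierLp 2 m :
          Lp ℂ 2 (volume : Measure (UnitAddTorus (Fin d)))) : UnitAddTorus (Fin d) → ℂ) -
            (hg.toLp : UnitAddTorus (Fin d) → ℂ)) 2 volume := by
    intro S
    have h1 : (∑ m ∈ S, c m • UnitAddTorus.mFourierLp 2 m :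
        Lp ℂ 2 (volume : Measure (UnitAddTorus (Fin d)))) =
        ContinuousMap.toLp 2 volume ℂ (∑ m ∈ S, c m • UnitAddTorus.mFourier m) := by
      rw [map_sum]
      simp_rw [map_smul]
    have h2 : (((∑ m ∈ S, c m • UnitAddTorus.mFourierLp 2 m :
          Lp ℂ 2 (volume : Measure (UnitAddTorus (Fin d)))) : UnitAddTorus (Fin d) → ℂ) -
            (hg.toLp : UnitAddTorus (Fin d) → ℂ)) =ᵐ[volume]
        -((fun τ => G τ - ∑ m ∈ S, c m * latticeExp m τ) ∘ torusRepr) := by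
      rw [h1]
      filter_upwards [ContinuousMap.coeFn_toLp (𝕜 := ℂ) (p := 2) volume
        (∑ m ∈ S, c m • UnitAddTorus.mFourier m), hg.coeFn_toLp] with θ e1 e2
      simp only [Pi.sub_apply, Pi.neg_apply, Function.comp_apply, e1, e2]
      simp [mFourier_eq_latticeExp]
    have hm : AEStronglyMeasurable (fun τ => G τ - ∑ m ∈ S, c m * latticeExp m τ)
        (ENNReal.ofReal ((2 * Real.pi) ^ d)⁻¹ • volume.restrict (periodCube d)) := by
      refine hG'.1.sub (Continuous.aestronglyMeasurable ?_)
      exact continuous_finsetSum _ fun m _ => continuous_const.mul (hlatc m)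
    rw [eLpNorm_congr_ae h2, eLpNorm_neg, eLpNorm_comp_measurePreserving hm hR,
      eLpNorm_smul_measure_of_ne_zero hk0, smul_eq_mul, ← mul_assoc, ENNReal.inv_mul_cancel,
      one_mul]
    · exact (ENNReal.rpow_pos (pos_iff_ne_zero.2 hk0) ENNReal.ofReal_ne_top).ne'
    · exact ENNReal.rpow_ne_top_of_nonneg ENNReal.toReal_nonneg ENNReal.ofReal_ne_top
  simp_rw [hconv]
  have hfin : ((ENNReal.ofReal ((2 * Real.pi) ^ d)⁻¹) ^ (1 / (2 : ENNReal)).toReal)⁻¹ ≠ ⊤ :=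
    ENNReal.inv_ne_top.2 (ENNReal.rpow_pos (pos_iff_ne_zero.2 hk0) ENNReal.ofReal_ne_top).ne'
  have := ENNReal.Tendsto.const_mul hsum' (Or.inr hfin)
  rwa [mul_zero] at this

end Torus

/-! ### The Toeplitz symbol -/

theorem continuous_latticeExp (m : Fin d → ℤ) : Continuous (latticeExp m) := by
  unfold latticeExp
  fun_prop

theorem latticePt_neg (m : Fin d → ℤ) : latticePt (-m) = -latticePt m := by
  ext j
  simp [latticePt_apply]

instance isFiniteMeasure_restrict_periodCube (d : ℕ) : IsFiniteMeasure
    ((volume : Measure (EuclideanSpace ℝ (Fin d))).restrict (periodCube d)) :=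
  ⟨by rw [Measure.restrict_apply_univ]; exact (isCompact_periodCube d).measure_lt_top⟩

theorem measurableSet_periodCube (d : ℕ) : MeasurableSet (periodCube d) :=
  (isCompact_periodCube d).isClosed.measurableSet

theorem periodCube_subset_closure_interior (d : ℕ) :
    periodCube d ⊆ closure (interior (periodCube d)) := by
  have hconv : Convex ℝ (periodCube d) := fun x hx y hy a b ha hb hab j =>
    (convex_Icc (-Real.pi) Real.pi) (hx j) (hy j) ha hb hab
  have hint : (interior (periodCube d)).Nonempty := by
    refine ⟨0, mem_interior_iff_mem_nhds.2 ?_⟩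
    refine mem_of_superset (Metric.ball_mem_nhds 0 Real.pi_pos) fun x hx j => ?_
    have h1 : |x j| ≤ ‖x‖ := by simpa using PiLp.norm_apply_le x j
    have h2 : ‖x‖ < Real.pi := by simpa using hx
    exact abs_le.1 (h1.trans h2.le)
  rw [hconv.closure_interior_eq_closure_of_nonempty_interior hint]
  exact subset_closure

/-- The Fourier coefficients of the Poisson sum are the complementary parts
`K(m) (1 - Γ(d/2+1, β²|m|²) / Γ(d/2+1))` of the kernel values. -/
theorem integral_tsum_ewaldPoissonTerm_mul_latticeExp (hd : 0 < d) {p : MvPolynomial (Fin d) ℂ}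
    (hp : p.IsHomogeneous 2) (hc : CancellationCondition p) {β : ℝ} (hβ : 0 < β)
    (m : Fin d → ℤ) :
    ∫ τ in periodCube d, (∑' n, ewaldPoissonTerm (kernelSymbol p) β n τ) * latticeExp (-m) τ =
      (((2 * Real.pi) ^ d : ℝ) : ℂ) * (kernelK p (latticePt m) *
        ((1 - upperGamma ((d : ℝ) / 2 + 1) (β ^ 2 * ‖latticePt m‖ ^ 2) /
          Real.Gamma ((d : ℝ) / 2 + 1) : ℝ) : ℂ)) := by
  have hβ2 : 0 < β ^ 2 := by positivity
  obtain ⟨C, -, hC⟩ := exists_norm_kernelSymbol_le hp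
  have h1 : Integrable fun ξ => kernelSymbol p ξ *
      ((Real.exp (-‖ξ‖ ^ 2 / (4 * β ^ 2)) : ℝ) : ℂ) * latticeExp (-m) ξ := by
    have h0 : Integrable fun ξ => kernelSymbol p ξ *
        ((Real.exp (-‖ξ‖ ^ 2 / (4 * β ^ 2)) : ℝ) : ℂ) :=
      (integrable_exp_neg_norm_sq_div hd hβ2).ofReal.bdd_mul
        (measurable_kernelSymbol p).aestronglyMeasurable (.of_forall hC)
    refine h0.mul_bdd (c := 1) (continuous_latticeExp _).aestronglyMeasurable
      (.of_forall fun ξ => (norm_latticeExp _ _).le)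
  have h2 := integral_periodCube_tsum h1
  simp_rw [latticeExp_add, tsum_mul_right] at h2
  refine h2.trans ((integral_kernelSymbol_mul_exp hd hp hc hβ2 (latticePt (-m))).trans ?_)
  rw [polyAt_mul_lowerWeight hp hβ2, latticePt_neg, norm_neg, kernelK, kernelK, norm_neg,
    show polyAt p (-latticePt m) = polyAt p (latticePt m) by
      have := polyAt_smul hp (-1) (latticePt m)
      simpa using this]

theorem continuousOn_ewaldRemainder {p : MvPolynomial (Fin d) ℂ} (hp : p.IsHomogeneous 2) {β : ℝ}
    (hβ : 0 < β) : ContinuousOn (ewaldRemainder p β) (periodCube d) := fun _ hτ =>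
  (analyticAt_ewaldRemainder hp hβ hτ).continuousAt.continuousWithinAt

theorem memLp_ewaldSymbol {p : MvPolynomial (Fin d) ℂ} (hp : p.IsHomogeneous 2) {β : ℝ}
    (hβ : 0 < β) : MemLp (ewaldSymbol p β) 2 (volume.restrict (periodCube d)) := by
  obtain ⟨C, hC⟩ := exists_norm_ewaldSymbol_le hp hβ
  refine MemLp.of_bound ?_ C (.of_forall hC)
  rw [show ewaldSymbol p β = kernelSymbol p + ewaldRemainder p β from
    funext (ewaldSymbol_eq hp hβ)]
  exact (measurable_kernelSymbol p).aestronglyMeasurable.add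
    ((continuousOn_ewaldRemainder hp hβ).aestronglyMeasurable (measurableSet_periodCube d))

theorem memLp_tsum_ewaldFourierTerm {p : MvPolynomial (Fin d) ℂ} (hp : p.IsHomogeneous 2)
    {β : ℝ} (hβ : 0 < β) : MemLp (fun τ => ∑' m : Fin d → ℤ, ewaldFourierTerm p β m τ) 2
      (volume.restrict (periodCube d)) := by
  obtain ⟨C, hC0, hC⟩ := exists_norm_ewaldFourierTerm_le hp β
  have hcont : Continuous fun τ => ∑' m : Fin d → ℤ, ewaldFourierTerm p β m τ :=
    continuous_iff_continuousAt.2 fun τ => (analyticAt_tsum_ewaldFourierTerm hp hβ τ).continuousAt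
  exact MemLp.of_bound hcont.aestronglyMeasurable _ (.of_forall fun τ =>
    tsum_of_norm_bounded ((summable_exp_neg_mul_norm_sq d (c := β ^ 2 / 2)
      (by positivity)).mul_left C).hasSum fun m => hC m _)

/-- The Ewald Fourier sum converges uniformly, hence in `L²` of the period cube. -/
theorem tendsto_eLpNorm_sub_sum_ewaldFourierTerm {p : MvPolynomial (Fin d) ℂ}
    (hp : p.IsHomogeneous 2) {β : ℝ} (hβ : 0 < β) :
    Tendsto (fun S : Finset (Fin d → ℤ) => eLpNorm (fun τ =>
      (∑' m, ewaldFourierTerm p β m τ) - ∑ m ∈ S, ewaldFourierTerm p β m τ) 2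
        (volume.restrict (periodCube d))) atTop (𝓝 0) := by
  obtain ⟨C, hC0, hC⟩ := exists_norm_ewaldFourierTerm_le hp β
  have hs := (summable_exp_neg_mul_norm_sq d (c := β ^ 2 / 2) (by positivity)).mul_left C
  have ht := tendsto_tsum_compl_atTop_zero fun m : Fin d → ℤ =>
    C * Real.exp (-(β ^ 2 / 2) * ‖latticePt m‖ ^ 2)
  have hbound : ∀ S : Finset (Fin d → ℤ), eLpNorm (fun τ =>
      (∑' m, ewaldFourierTerm p β m τ) - ∑ m ∈ S, ewaldFourierTerm p β m τ) 2
        (volume.restrict (periodCube d)) ≤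
      ((volume.restrict (periodCube d)) Set.univ) ^ (2 : ENNReal).toReal⁻¹ * ENNReal.ofReal
        (∑' m : {m // m ∉ S}, C * Real.exp (-(β ^ 2 / 2) * ‖latticePt m.1‖ ^ 2)) := fun S => by
    refine eLpNorm_le_of_ae_bound (.of_forall fun τ => ?_)
    rw [← (summable_ewaldFourierTerm hp hβ τ).sum_add_tsum_subtype_compl S, add_sub_cancel_left]
    exact tsum_of_norm_bounded (hs.subtype _).hasSum fun m => hC m.1 τ
  refine tendsto_of_tendsto_of_tendsto_of_le_of_le tendsto_const_nhds ?_ (fun _ => zero_le)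
    hbound
  have h2 := ENNReal.Tendsto.const_mul (ENNReal.tendsto_ofReal ht)
    (a := ((volume.restrict (periodCube d)) Set.univ) ^ (2 : ENNReal).toReal⁻¹)
    (Or.inr (ENNReal.rpow_ne_top_of_nonneg (by positivity) (measure_ne_top _ _)))
  rwa [ENNReal.ofReal_zero, mul_zero] at h2

/-- The Ewald representation is the sum in `L²` of the Fourier series with coefficients `K(m)`. -/
theorem tendsto_eLpNorm_ewaldSymbol_sub (hd : 0 < d) {p : MvPolynomial (Fin d) ℂ}
    (hp : p.IsHomogeneous 2) (hc : CancellationCondition p) {β : ℝ} (hβ : 0 < β) :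
    Tendsto (fun S : Finset (Fin d → ℤ) => eLpNorm (fun τ =>
      ewaldSymbol p β τ - ∑ m ∈ S, kernelK p (latticePt m) * latticeExp m τ) 2
        (volume.restrict (periodCube d))) atTop (𝓝 0) := by
  have hF := memLp_ewaldSymbol hp hβ
  have hH := memLp_tsum_ewaldFourierTerm hp hβ
  have hG : MemLp (fun τ => ∑' n, ewaldPoissonTerm (kernelSymbol p) β n τ) 2
      (volume.restrict (periodCube d)) :=
    (hF.sub hH).congr_norm (hF.sub hH).1 (.of_forall fun τ => rfl) |>.ae_eq
      (.of_forall fun τ => by simp [ewaldSymbol])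
  have h1 := tendsto_eLpNorm_sub_fourierSeries hG fun m =>
    (integral_tsum_ewaldPoissonTerm_mul_latticeExp hd hp hc hβ m).symm
  have h2 := tendsto_eLpNorm_sub_sum_ewaldFourierTerm hp hβ
  have h3 := h1.add h2
  rw [add_zero] at h3
  refine tendsto_of_tendsto_of_tendsto_of_le_of_le tendsto_const_nhds h3 (fun _ => zero_le)
    fun S => ?_
  have hcT : ∀ m : Fin d → ℤ, Continuous (ewaldFourierTerm p β m) := fun m =>
    continuous_const.mul (continuous_latticeExp m)
  refine le_of_eq_of_le ?_ (eLpNorm_add_le (hG.1.sub (Continuous.aestronglyMeasurable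
    (continuous_finsetSum S fun m _ => continuous_const.mul (continuous_latticeExp m))))
    (hH.1.sub (Continuous.aestronglyMeasurable (continuous_finsetSum S fun m _ => hcT m)))
    one_le_two)
  congr 1
  funext τ
  simp only [Pi.add_apply, ewaldSymbol]
  have e : ∑ m ∈ S, kernelK p (latticePt m) * latticeExp m τ =
      (∑ m ∈ S, kernelK p (latticePt m) *
        ((1 - upperGamma ((d : ℝ) / 2 + 1) (β ^ 2 * ‖latticePt m‖ ^ 2) /
          Real.Gamma ((d : ℝ) / 2 + 1) : ℝ) : ℂ) * latticeExp m τ) +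
        ∑ m ∈ S, ewaldFourierTerm p β m τ := by
    rw [← Finset.sum_add_distrib]
    refine Finset.sum_congr rfl fun m _ => ?_
    rw [ewaldFourierTerm]
    push_cast
    ring
  rw [e]
  ring

theorem isToeplitzSymbol_ewaldSymbol (hd : 0 < d) {p : MvPolynomial (Fin d) ℂ}
    (hp : p.IsHomogeneous 2) (hc : CancellationCondition p) {β : ℝ} (hβ : 0 < β) :
    IsToeplitzSymbol p (ewaldSymbol p β) := by
  refine ⟨ewaldSymbol_periodic p β, memLp_ewaldSymbol hp hβ, ?_⟩
  -- The index `0` may be added to every partial sum, since `kernelK p 0 = 0`.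
  have hmap : Tendsto (fun S : Finset {m : Fin d → ℤ // m ≠ 0} =>
      insert 0 (S.map (Function.Embedding.subtype _))) atTop atTop := by
    refine tendsto_atTop_atTop_of_monotone
      (fun S T h => Finset.insert_subset_insert _ (Finset.map_subset_map.2 h)) fun T =>
        ⟨T.subtype _, fun m hm => ?_⟩
    by_cases h : m = 0
    · simp [h]
    · simp [h, hm]
  refine ((tendsto_eLpNorm_ewaldSymbol_sub hd hp hc hβ).comp hmap).congr fun S => ?_
  refine congrArg (fun f => eLpNorm f 2 (volume.restrict (periodCube d))) (funext fun τ => ?_)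
  rw [Finset.sum_insert (by simp), Finset.sum_map, latticePt_zero, kernelK_zero hp, zero_mul,
    zero_add]
  rfl

/-- The Ewald representation does not depend on the splitting parameter. -/
theorem ewaldSymbol_eqOn (hd : 0 < d) {p : MvPolynomial (Fin d) ℂ} (hp : p.IsHomogeneous 2)
    (hc : CancellationCondition p) {β γ : ℝ} (hβ : 0 < β) (hγ : 0 < γ) :
    Set.EqOn (ewaldSymbol p β) (ewaldSymbol p γ) (periodCube d) := by
  have hFβ := memLp_ewaldSymbol hp hβ
  have hFγ := memLp_ewaldSymbol hp hγ
  have h0 : eLpNorm (ewaldSymbol p β - ewaldSymbol p γ) 2 (volume.restrict (periodCube d)) = 0 := by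
    have h3 := (tendsto_eLpNorm_ewaldSymbol_sub hd hp hc hβ).add
      (tendsto_eLpNorm_ewaldSymbol_sub hd hp hc hγ)
    rw [add_zero] at h3
    refine le_antisymm (ge_of_tendsto' h3 fun S => ?_) zero_le
    have hS : AEStronglyMeasurable
        (fun τ => ∑ m ∈ S, kernelK p (latticePt m) * latticeExp m τ)
        (volume.restrict (periodCube d)) := Continuous.aestronglyMeasurable
      (continuous_finsetSum S fun m _ => continuous_const.mul (continuous_latticeExp m))
    refine le_of_eq_of_le ?_ (eLpNorm_sub_le (hFβ.1.sub hS) (hFγ.1.sub hS) one_le_two)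
    congr 1
    funext τ
    simp
  have hae : ewaldRemainder p β =ᵐ[volume.restrict (periodCube d)] ewaldRemainder p γ := by
    filter_upwards [(eLpNorm_eq_zero_iff (hFβ.1.sub hFγ.1) two_ne_zero).1 h0] with τ hτ
    simpa [ewaldSymbol_eq hp hβ, ewaldSymbol_eq hp hγ, sub_eq_zero] using hτ
  intro τ hτ
  rw [ewaldSymbol_eq hp hβ, ewaldSymbol_eq hp hγ]
  congr 1
  exact Measure.eqOn_of_ae_eq hae (continuousOn_ewaldRemainder hp hβ)
    (continuousOn_ewaldRemainder hp hγ) (periodCube_subset_closure_interior d) hτ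

end

theorem propositionP (d : ℕ) (hd : 2 ≤ d) (p : MvPolynomial (Fin d) ℂ)
    (hp : p.IsHomogeneous 2) (hc : CancellationCondition p) :
    (∃ Khat : EuclideanSpace ℝ (Fin d) → ℂ, IsKernelSymbol p Khat) ∧
    ∃ F : EuclideanSpace ℝ (Fin d) → ℂ,
      IsToeplitzSymbol p F ∧
      (∃ C : ℝ, ∀ τ, ‖F τ‖ ≤ C) ∧
      (∀ τ ∈ periodCube d \ {0}, ContDiffAt ℝ (⊤ : ℕ∞) F τ) ∧
      ∀ Khat : EuclideanSpace ℝ (Fin d) → ℂ, IsKernelSymbol p Khat →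
        (∀ β : ℝ, 0 < β →
          ExponentiallyConvergentOn (fun m : {m : Fin d → ℤ // m ≠ 0} => m.1)
            (fun m τ => ewaldFourierTerm p β m.1 τ) (periodCube d \ {0}) ∧
          ExponentiallyConvergentOn (fun n : Fin d → ℤ => n)
            (fun n τ => ewaldPoissonTerm Khat β n τ) (periodCube d \ {0}) ∧
          ∀ τ ∈ periodCube d \ {0},
            F τ = (∑' m : {m : Fin d → ℤ // m ≠ 0}, ewaldFourierTerm p β m.1 τ) +
              (∑' n : Fin d → ℤ, ewaldPoissonTerm Khat β n τ)) ∧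
        ∃ F₀ : EuclideanSpace ℝ (Fin d) → ℂ,
          AnalyticOnNhd ℝ F₀ (periodCube d) ∧ F₀ 0 = 0 ∧
          ∀ τ ∈ periodCube d \ {0}, F τ = Khat τ + F₀ τ := by
  have hd0 : 0 < d := by omega
  refine ⟨⟨_, isKernelSymbol_kernelSymbol hd0 hp hc⟩, ewaldSymbol p 1,
    isToeplitzSymbol_ewaldSymbol hd0 hp hc one_pos, exists_norm_ewaldSymbol_le hp one_pos,
    fun τ hτ => ?_, fun Khat hK => ⟨fun β hβ => ?_, ewaldRemainder p 1,
      fun τ hτ => analyticAt_ewaldRemainder hp one_pos hτ, ewaldRemainder_zero hd0 hp hc one_pos,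
      fun τ hτ => ?_⟩⟩
  · rw [show ewaldSymbol p 1 = kernelSymbol p + ewaldRemainder p 1 from
      funext (ewaldSymbol_eq hp one_pos)]
    exact ((analyticAt_kernelSymbol hp hτ.2).add
      (analyticAt_ewaldRemainder hp one_pos hτ.1)).contDiffAt
  · have hPoisson : ∀ n : Fin d → ℤ, ∀ τ ∈ periodCube d \ {0},
        ewaldPoissonTerm Khat β n τ = ewaldPoissonTerm (kernelSymbol p) β n τ := fun n τ hτ => by
      rw [ewaldPoissonTerm, hK.eq_kernelSymbol hd0 hp hc (add_lattice_ne_zero hτ n),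
        ewaldPoissonTerm]
    obtain ⟨C, -, hC⟩ := exists_norm_ewaldFourierTerm_le hp β
    obtain ⟨D, -, hD⟩ := exists_norm_ewaldPoissonTerm_le hp hβ
    refine ⟨exponentiallyConvergentOn_of_norm_le Subtype.val_injective (by positivity)
      fun m τ _ => hC m.1 τ, exponentiallyConvergentOn_of_norm_le Function.injective_id
        (C := D)
        (c := Real.pi ^ 2 / (4 * β ^ 2)) (by positivity) fun n τ hτ => ?_, fun τ hτ => ?_⟩
    · rw [hPoisson n τ hτ]
      exact hD n τ hτ.1
    · rw [ewaldSymbol_eqOn hd0 hp hc one_pos hβ hτ.1, ewaldSymbol,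
        tsum_congr fun n => hPoisson n τ hτ,
        tsum_eq_zero_add_subtype (summable_ewaldFourierTerm hp hβ τ) 0, ewaldFourierTerm,
        latticePt_zero, kernelK_zero hp, zero_mul, zero_mul, zero_add]
  · rw [ewaldSymbol_eq hp one_pos, hK.eq_kernelSymbol hd0 hp hc hτ.2]
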